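/- All logarithms are to base $2$. For a finite undirected unweighted graph $G=(V,E)$ on $n$ nodes and a non-empty set $S\subseteq V$ put $\Phi_G(S)=|\mathrm{cut}_G(S)|/\mathrm{vol}_G(S)$, where $\mathrm{cut}_G(S)$ is the set of edges with exactly one end-point in $S$ and $\mathrm{vol}_G(S)$ is the sum of the degrees of the nodes of $S$ (so $\Phi_G(S)=|\mathrm{cut}_G(S)|/(d|S|)$ if $G$ is $d$-regular). The graph $G$ is $\delta$-hyperbolic if for every three nodes $u,v,w$ and all shortest paths $\overline{u,v}$, $\overline{u,w}$, $\overline{v,w}$ between them, every node of $\overline{u,v}$ is at distance at most $\delta$ from some node of $\overline{u,w}$ or $\overline{v,w}$. There is a universal constant $\eta>0$ such that for all constants $0<\rho<1/3$, $0<\zeta<1/2$ and $0<\varepsilon\le 1$ there are a deterministic algorithm $A$ (a program of a random access machine whose arithmetic operations are addition and truncated subtraction, each at unit cost) and a polynomial $P$ with the following property. Let $G$ be a connected $d$-regular $\delta$-hyperbolic graph on $n$ nodes with $$d\le 2^{(\log n)^{1/3-\rho}}\qquad\text{and}\qquad \delta\le(\log n)^{\rho},$$ and suppose that there is a non-empty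 set $S$ of at most $\zeta n$ nodes of $G$ with $\Phi_G(S)\le\varepsilon$. Then $A$, given the adjacency matrix of $G$, halts after at most $P(n)$ steps and outputs a non-empty set $S'$ of at most $\zeta n$ nodes of $G$ with $\Phi_G(S')\le\eta\,\varepsilon$. -/

import Mathlib

/-! ### Graph notions -/

/-- `G` is `δ`-hyperbolic (thin geodesic triangles): for all shortest paths `puv`, `puw`, `pvw`
between three nodes, every node of `puv` is within distance `δ` of a node of `puw` or `pvw`.
(A walk whose length is the distance of its ends is the same thing as a shortest path.) -/
def IsHyperbolic {V : Type*} (G : SimpleGraph V) (δ : ℝ) : Prop :=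
  ∀ (u v w : V) (puv : G.Walk u v) (puw : G.Walk u w) (pvw : G.Walk v w),
    puv.length = G.dist u v → puw.length = G.dist u w → pvw.length = G.dist v w →
    ∀ x ∈ puv.support, ∃ y, (y ∈ puw.support ∨ y ∈ pvw.support) ∧ (G.dist x y : ℝ) ≤ δ

section Expansion

variable {V : Type*} [Fintype V] [DecidableEq V]

/-- The number of edges of `G` with exactly one end in `S` (each such edge is counted once, as the
pair of its end inside `S` and its end outside `S`). -/
def cutSize (G : SimpleGraph V) [DecidableRel G.Adj] (S : Finset V) : ℕ :=
  (G.interedges S Sᶜ).card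

/-- The volume of `S`: the sum of the degrees of the nodes of `S`. -/
def vol (G : SimpleGraph V) [DecidableRel G.Adj] (S : Finset V) : ℕ :=
  ∑ v ∈ S, G.degree v

/-- The normalized edge expansion `|cut(S)| / vol(S)`. -/
noncomputable def normExpansion (G : SimpleGraph V) [DecidableRel G.Adj] (S : Finset V) : ℝ :=
  (cutSize G S : ℝ) / (vol G S : ℝ)

/-- `S` is a non-empty set of at most `ζ |V|` nodes with normalized expansion at most `ε`. -/
def IsSmallNonexpanding (G : SimpleGraph V) [DecidableRel G.Adj] (ζ ε : ℝ) (S : Finset V) : Prop :=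
  S.Nonempty ∧ (S.card : ℝ) ≤ ζ * (Fintype.card V : ℝ) ∧ normExpansion G S ≤ ε

end Expansion

/-! ### The machine model

A random access machine over the natural numbers, programmed with assignments, branching and
`while` loops.  A fixed program mentions finitely many registers and finitely many arrays.  The
arithmetic operations are addition and truncated subtraction (no multiplication), so that the
bit length of the numbers grows by `O(1)` per step and the unit-cost running time agrees with
Turing machine time up to a polynomial. -/

namespace RAM

/-- A memory state: the contents of the registers and of the arrays. -/
structure State where
  reg : ℕ → ℕ
  arr : ℕ → ℕ → ℕ

/-- Expressions: constants, registers, array access, addition, truncated subtraction. -/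
inductive Expr where
  | const (c : ℕ)
  | reg (x : ℕ)
  | get (a : ℕ) (i : Expr)
  | add (e f : Expr)
  | sub (e f : Expr)

/-- The value of an expression. -/
def Expr.eval (s : State) : Expr → ℕ
  | .const c => c
  | .reg x => s.reg x
  | .get a i => s.arr a (i.eval s)
  | .add e f => e.eval s + f.eval s
  | .sub e f => e.eval s - f.eval s

/-- The number of steps for evaluating an expression: one for each of its nodes. -/
def Expr.cost : Expr → ℕ
  | .const _ => 1
  | .reg _ => 1
  | .get _ i => i.cost + 1
  | .add e f => e.cost + f.cost + 1
  | .sub e f => e.cost + f.cost + 1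

/-- Programs. A condition is an expression; it holds when its value is not zero. -/
inductive Program where
  | skip
  | assign (x : ℕ) (e : Expr)
  | store (a : ℕ) (i e : Expr)
  | seq (p q : Program)
  | ite (e : Expr) (p q : Program)
  | loop (e : Expr) (p : Program)

/-- `Exec p s t s'`: started in the state `s`, the program `p` halts after exactly `t` steps, in
the state `s'`. -/
inductive Exec : Program → State → ℕ → State → Prop where
  | skip (s : State) : Exec .skip s 1 s
  | assign (x : ℕ) (e : Expr) (s : State) :
      Exec (.assign x e) s (e.cost + 1) ⟨Function.update s.reg x (e.eval s), s.arr⟩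
  | store (a : ℕ) (i e : Expr) (s : State) :
      Exec (.store a i e) s (i.cost + e.cost + 1)
        ⟨s.reg, Function.update s.arr a (Function.update (s.arr a) (i.eval s) (e.eval s))⟩
  | seq {p q : Program} {s s' s'' : State} {t t' : ℕ} :
      Exec p s t s' → Exec q s' t' s'' → Exec (.seq p q) s (t + t') s''
  | ite_true {e : Expr} {p q : Program} {s s' : State} {t : ℕ} :
      e.eval s ≠ 0 → Exec p s t s' → Exec (.ite e p q) s (e.cost + 1 + t) s'
  | ite_false {e : Expr} {p q : Program} {s s' : State} {t : ℕ} :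
      e.eval s = 0 → Exec q s t s' → Exec (.ite e p q) s (e.cost + 1 + t) s'
  | loop_done {e : Expr} {p : Program} {s : State} :
      e.eval s = 0 → Exec (.loop e p) s (e.cost + 1) s
  | loop_step {e : Expr} {p : Program} {s s' s'' : State} {t t' : ℕ} :
      e.eval s ≠ 0 → Exec p s t s' → Exec (.loop e p) s' t' s'' →
        Exec (.loop e p) s (e.cost + 1 + t + t') s''

/-- The input: register `0` holds the number `n` of nodes, array `0` holds the adjacency matrix
row by row; everything else is zero. -/
def input {n : ℕ} (G : SimpleGraph (Fin n)) [DecidableRel G.Adj] : State where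
  reg x := if x = 0 then n else 0
  arr a k :=
    if a = 0 ∧ ∃ i j : Fin n, G.Adj i j ∧ k = (i : ℕ) * n + (j : ℕ) then 1 else 0

/-- The output, a set of nodes: array `1` holds its indicator function. -/
def output (n : ℕ) (s : State) : Finset (Fin n) :=
  Finset.univ.filter fun i => s.arr 1 (i : ℕ) ≠ 0

end RAM

/-! The factor `η = 1` suffices. Fix integers `K ≥ 1/ζ` and `M ≥ 1/ε`. Every sufficiently large
graph of the given kind contains a set of at most `n/K` nodes whose cut is at most `1/M` of its
volume, and this set is a stage of a breadth first search of a shape that polynomial time can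
enumerate.

Since balls of radius `R` have at most `(d+1)^R` nodes, a large graph has a long geodesic. Mark
positions on it at spacing `w`. Each odd position is the center of a search that may not enter the
balls of radius `r` around its two even neighbours. Repeated halving with thin triangles shows that
a walk of at most `2^N` steps comes within `δN` of every node of a geodesic between its ends
(`exists_near_of_seq`). Hence for `r ≥ δ(N+1)` a search of at most `2^N` rounds cannot bypass a
forbidden ball, and searches from different centers stay disjoint (`disjoint_confined_searches`).
Among `K` of them, one covers at most `n/K` nodes.

If all stages of that search had a large cut, each round would multiply its size by at least `1 +
1/(2M)`, and after `2M log n` rounds, roughly, it would exceed `n` (`exists_small_cut`). The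
forbidden balls do not spoil this: they are too far away to matter in the early rounds, and
afterwards the search is so large that edges into them account for too little of the cut. With `L =
log n`, the choices `N ≈ L^(ρ/2)`, `r ≈ L^(3ρ/2)` and `w ≈ r L^(1/3-ρ)` up to constants need a
geodesic of length about `w`, and `w log(d+1)` is of order at most `L^(2/3-ρ/2)`, below `L`
(`exists_search_parameters`).

The program tries all pairs of ball centers, radii, search centers and stages. The finitely many
graphs below the size threshold are handled by a decision table. -/

namespace HyperbolicCut

open Finset

/-! ### Geodesics and thin triangles -/

section Metric

variable {V : Type*} {G : SimpleGraph V} {δ : ℝ}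

/-- `x` lies on a shortest path from `u` to `v`. -/
def Between (G : SimpleGraph V) (u x v : V) : Prop :=
  G.dist u x + G.dist x v = G.dist u v

theorem between_of_mem_support (hG : G.Connected) {u v y : V} (p : G.Walk u v)
    (hp : p.length = G.dist u v) (hy : y ∈ p.support) : Between G u y v := by
  classical
  have h1 := SimpleGraph.dist_le (p.takeUntil y hy)
  have h2 := SimpleGraph.dist_le (p.dropUntil y hy)
  have h3 := congrArg SimpleGraph.Walk.length (p.take_spec hy)
  rw [SimpleGraph.Walk.length_append] at h3
  have h4 := hG.dist_triangle (u := u) (v := y) (w := v)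
  unfold Between
  omega

/-- Geodesics from `u` to `x` and from `x` to `v` concatenate to a geodesic through `x`, so thinness
can be used without mentioning walks. -/
theorem exists_near_side (hG : G.Connected) (h : IsHyperbolic G δ) {u v x : V} (w : V)
    (hx : Between G u x v) :
    ∃ y, (Between G u y w ∨ Between G v y w) ∧ (G.dist x y : ℝ) ≤ δ := by
  obtain ⟨p₁, h₁⟩ := hG.exists_walk_length_eq_dist u x
  obtain ⟨p₂, h₂⟩ := hG.exists_walk_length_eq_dist x v
  obtain ⟨q₁, k₁⟩ := hG.exists_walk_length_eq_dist u w
  obtain ⟨q₂, k₂⟩ := hG.exists_walk_length_eq_dist v w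
  obtain ⟨y, hy, hd⟩ := h u v w (p₁.append p₂) q₁ q₂
    (by rw [SimpleGraph.Walk.length_append, h₁, h₂]; exact hx) k₁ k₂ x (by simp)
  exact ⟨y, hy.imp (between_of_mem_support hG q₁ k₁) (between_of_mem_support hG q₂ k₂), hd⟩

theorem nonneg_of_isHyperbolic (hG : G.Connected) (h : IsHyperbolic G δ) : 0 ≤ δ := by
  obtain ⟨v⟩ := hG.nonempty
  obtain ⟨y, -, hy⟩ := exists_near_side hG h (u := v) (v := v) (x := v) v (by simp [Between])
  exact le_trans (by positivity) hy

/-- A sequence of `2 ^ N` steps comes within `δ N` of every node of every shortest path between its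
ends. -/
theorem exists_near_of_seq (hG : G.Connected) (h : IsHyperbolic G δ) (N : ℕ) :
    ∀ f : ℕ → V, (∀ i, G.dist (f i) (f (i + 1)) ≤ 1) → ∀ x, Between G (f 0) x (f (2 ^ N)) →
      ∃ i, (G.dist x (f i) : ℝ) ≤ δ * N := by
  induction N with
  | zero =>
    intro f hf x hx
    have h1 := hf 0
    simp only [Between, pow_zero, zero_add] at hx h1
    rcases Nat.eq_zero_or_pos (G.dist (f 0) x) with h0 | h0
    · exact ⟨0, by rw [SimpleGraph.dist_comm, h0]; simp⟩
    · exact ⟨1, by rw [show G.dist x (f 1) = 0 by omega]; simp⟩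
  | succ N ih =>
    intro f hf x hx
    -- The midpoint of the sequence is the third corner: one triangle costs `δ` and leaves a side
    -- spanned by half of the sequence.
    obtain ⟨y, hy | hy, hd⟩ := exists_near_side hG h (f (2 ^ N)) hx
    · obtain ⟨i, hi⟩ := ih f hf y hy
      refine ⟨i, ?_⟩
      have := hG.dist_triangle (u := x) (v := y) (w := f i)
      have : (G.dist x (f i) : ℝ) ≤ G.dist x y + G.dist y (f i) := mod_cast this
      push_cast
      linarith
    · obtain ⟨i, hi⟩ := ih (fun i => f (2 ^ N + i)) (fun i => hf _) y (by
        have e : 2 ^ N + 2 ^ N = 2 ^ (N + 1) := by ring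
        simp only [Between, add_zero, e] at hy ⊢
        rw [SimpleGraph.dist_comm, add_comm, SimpleGraph.dist_comm, hy, SimpleGraph.dist_comm])
      refine ⟨2 ^ N + i, ?_⟩
      have := hG.dist_triangle (u := x) (v := y) (w := f (2 ^ N + i))
      have : (G.dist x (f (2 ^ N + i)) : ℝ) ≤ G.dist x y + G.dist y (f (2 ^ N + i)) :=
        mod_cast this
      push_cast
      linarith

/-- The nodes of a shortest path of length `D`. -/
theorem exists_geodesic_seq (hG : G.Connected) (u v : V) :
    ∃ γ : ℕ → V, ∀ i j, i ≤ j → j ≤ G.dist u v → G.dist (γ i) (γ j) = j - i := by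
  obtain ⟨p, hp⟩ := hG.exists_walk_length_eq_dist u v
  have step : ∀ i, G.dist (p.getVert i) (p.getVert (i + 1)) ≤ 1 := by
    intro i
    rcases lt_or_ge i p.length with hi | hi
    · exact (SimpleGraph.dist_eq_one_iff_adj.2 (p.adj_getVert_succ hi)).le
    · rw [p.getVert_of_length_le hi, p.getVert_of_length_le (by omega)]
      simp
  have far : ∀ i k, G.dist (p.getVert i) (p.getVert (i + k)) ≤ k := by
    intro i k
    induction k with
    | zero => simp
    | succ k ih =>
      have := hG.dist_triangle (u := p.getVert i) (v := p.getVert (i + k))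
        (w := p.getVert (i + k + 1))
      have := step (i + k)
      rw [← add_assoc]
      omega
  refine ⟨p.getVert, fun i j hij hj => ?_⟩
  -- The three pieces of the walk have distances at most their lengths, which add up to the distance
  -- of the ends; so all are equalities.
  have h1 := far 0 i
  have h2 := far i (j - i)
  have h3 := far j (p.length - j)
  rw [show i + (j - i) = j by omega] at h2
  rw [show j + (p.length - j) = p.length by omega] at h3
  rw [zero_add] at h1
  simp only [SimpleGraph.Walk.getVert_zero, SimpleGraph.Walk.getVert_length] at h1 h3
  have h4 := hG.dist_triangle (u := u) (v := p.getVert i) (w := v)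
  have h5 := hG.dist_triangle (u := p.getVert i) (v := p.getVert j) (w := v)
  omega

end Metric

/-! ### Breadth first searches with a forbidden set -/

section Expand

variable {V : Type*} [Fintype V]

open Classical in
/-- One round of breadth first search from `S` that does not enter `B`. -/
noncomputable def expand (G : SimpleGraph V) (B S : Finset V) : Finset V :=
  univ.filter fun v => v ∈ S ∨ (v ∉ B ∧ ∃ u ∈ S, G.Adj u v)

variable {G : SimpleGraph V} {B S : Finset V}

theorem mem_expand {v : V} : v ∈ expand G B S ↔ v ∈ S ∨ (v ∉ B ∧ ∃ u ∈ S, G.Adj u v) := by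
  simp [expand]

theorem subset_expand : S ⊆ expand G B S := fun _ hv => mem_expand.2 (Or.inl hv)

theorem iterate_expand_mono {s t : ℕ} (h : s ≤ t) : (expand G B)^[s] S ⊆ (expand G B)^[t] S := by
  induction t, h using Nat.le_induction with
  | base => exact subset_rfl
  | succ t _ ih =>
    rw [Function.iterate_succ_apply']
    exact ih.trans subset_expand

theorem exists_dist_le_of_mem_iterate_expand (hG : G.Connected) {s : ℕ} :
    ∀ {v : V}, v ∈ (expand G B)^[s] S → ∃ u ∈ S, G.dist u v ≤ s := by
  induction s with
  | zero => exact fun {v} hv => ⟨v, hv, by simp⟩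
  | succ s ih =>
    intro v hv
    rw [Function.iterate_succ_apply', mem_expand] at hv
    rcases hv with hv | ⟨-, w, hw, hwv⟩
    · obtain ⟨u, hu, hd⟩ := ih hv
      exact ⟨u, hu, by omega⟩
    · obtain ⟨u, hu, hd⟩ := ih hw
      have := hG.dist_triangle (u := u) (v := w) (w := v)
      have := SimpleGraph.dist_eq_one_iff_adj.2 hwv
      exact ⟨u, hu, by omega⟩

theorem mem_iterate_expand_of_walk {u v : V} (p : G.Walk u v) :
    ∀ {S : Finset V}, u ∈ S → v ∈ (expand G ∅)^[p.length] S := by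
  induction p with
  | nil => exact fun h => h
  | cons h p ih =>
    intro S hu
    rw [SimpleGraph.Walk.length_cons, Function.iterate_succ_apply]
    exact ih (mem_expand.2 (Or.inr ⟨by simp, _, hu, h⟩))

theorem mem_iterate_expand_of_dist_le (hG : G.Connected) {u v : V} {r : ℕ} (hu : u ∈ S)
    (h : G.dist u v ≤ r) : v ∈ (expand G ∅)^[r] S := by
  obtain ⟨p, hp⟩ := hG.exists_walk_length_eq_dist u v
  exact iterate_expand_mono (hp ▸ h) (mem_iterate_expand_of_walk p hu)

/-- Tracing a node back through the rounds gives the sequence. It may stand still, which lets its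
length be exactly the number of rounds. -/
theorem exists_seq_of_mem_iterate_expand {p : V} (hp : p ∉ B) {s : ℕ} :
    ∀ {v : V}, v ∈ (expand G B)^[s] {p} →
      ∃ f : ℕ → V, f 0 = p ∧ f s = v ∧ (∀ i, G.dist (f i) (f (i + 1)) ≤ 1) ∧ ∀ i, f i ∉ B := by
  induction s with
  | zero =>
    intro v hv
    obtain rfl : v = p := by simpa using hv
    exact ⟨fun _ => v, rfl, rfl, by simp, fun _ => hp⟩
  | succ s ih =>
    intro v hv
    have key : ∃ u ∈ (expand G B)^[s] {p}, G.dist u v ≤ 1 ∧ (u = v ∨ v ∉ B) := by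
      rw [Function.iterate_succ_apply', mem_expand] at hv
      rcases hv with hv | ⟨hB, w, hw, hwv⟩
      · exact ⟨v, hv, by simp, Or.inl rfl⟩
      · exact ⟨w, hw, (SimpleGraph.dist_eq_one_iff_adj.2 hwv).le, Or.inr hB⟩
    obtain ⟨u, hu, hd, hB⟩ := key
    obtain ⟨f, h0, hs, hf, hfB⟩ := ih hu
    have hvB : v ∉ B := hB.elim (fun e => e ▸ hs ▸ hfB s) id
    refine ⟨fun i => if i ≤ s then f i else v, by simpa using h0, by simp, fun i => ?_,
      fun i => ?_⟩
    · rcases lt_trichotomy i s with hi | rfl | hi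
      · simpa [hi.le, Nat.succ_le_of_lt hi] using hf i
      · simpa [hs] using hd
      · simp [show ¬ i ≤ s by omega, show ¬ i + 1 ≤ s by omega]
    · by_cases hi : i ≤ s
      · simpa [hi] using hfB i
      · simpa [hi] using hvB

theorem card_expand_le [DecidableRel G.Adj] {d : ℕ} (hd : ∀ v, G.degree v ≤ d) :
    (expand G B S).card ≤ (d + 1) * S.card := by
  classical
  have hsub : expand G B S ⊆ S ∪ S.biUnion fun u => G.neighborFinset u := by
    intro v hv
    rcases mem_expand.1 hv with hv | ⟨-, u, hu, huv⟩
    · exact mem_union_left _ hv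
    · exact mem_union_right _ (mem_biUnion.2 ⟨u, hu, by simpa using huv⟩)
  have h2 : (S.biUnion fun u => G.neighborFinset u).card ≤ S.card * d :=
    card_biUnion_le_card_mul _ _ _ fun u _ => by simpa using hd u
  calc _ ≤ _ := card_le_card hsub
    _ ≤ _ := card_union_le _ _
    _ ≤ S.card + S.card * d := by omega
    _ = _ := by ring

theorem card_iterate_expand_le [DecidableRel G.Adj] {d : ℕ} (hd : ∀ v, G.degree v ≤ d) (r : ℕ) :
    ((expand G B)^[r] S).card ≤ (d + 1) ^ r * S.card := by
  induction r with
  | zero => simp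
  | succ r ih =>
    rw [Function.iterate_succ_apply']
    calc _ ≤ _ := card_expand_le hd
      _ ≤ (d + 1) * ((d + 1) ^ r * S.card) := Nat.mul_le_mul_left _ ih
      _ = _ := by ring

/-- A ball of radius `R` has at most `(d+1)^R` nodes and so cannot be the whole graph. -/
theorem exists_lt_dist [DecidableRel G.Adj] (hG : G.Connected) {d R : ℕ}
    (hd : ∀ v, G.degree v ≤ d) (hR : (d + 1) ^ R < Fintype.card V) :
    ∃ u v, R < G.dist u v := by
  by_contra! hcon
  obtain ⟨u⟩ := hG.nonempty
  have h1 : (univ : Finset V) ⊆ (expand G ∅)^[R] {u} := fun v _ =>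
    mem_iterate_expand_of_dist_le hG (mem_singleton_self u) (hcon u v)
  have h2 := (card_le_card h1).trans (card_iterate_expand_le hd R)
  simp only [card_univ, card_singleton, mul_one] at h2
  omega

theorem dist_lt_card (hG : G.Connected) (u v : V) : G.dist u v < Fintype.card V := by
  obtain ⟨p, hp, hl⟩ := hG.exists_path_of_dist u v
  exact hl ▸ hp.length_lt

/-- A search that avoids a large ball around `x` cannot reach, in few rounds, a node such that a
shortest path to it passes close to `x`. -/
theorem not_near_of_mem_iterate_expand (hG : G.Connected) {δ : ℝ} (h : IsHyperbolic G δ)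
    {p x y z : V} {s N r : ℕ} (hr : δ * (N + 1) ≤ r) (hB : ∀ v, G.dist x v ≤ r → v ∈ B)
    (hp : p ∉ B) (hs : s ≤ 2 ^ N) (hz : z ∈ (expand G B)^[s] {p}) (hy : Between G p y z) :
    ¬ (G.dist x y : ℝ) ≤ δ := by
  intro hxy
  obtain ⟨f, h0, hfs, hf, hfB⟩ := exists_seq_of_mem_iterate_expand hp hz
  -- Stopping the sequence at `s` pads it to the `2 ^ N` steps required; its near node is then
  -- within `δ + δN ≤ r` of `x`, hence in `B`.
  obtain ⟨i, hi⟩ := exists_near_of_seq hG h N (fun i => f (min i s))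
    (fun i => by
      rcases lt_or_ge i s with h | h
      · simpa [min_eq_left h.le, min_eq_left (Nat.succ_le_of_lt h)] using hf i
      · simp [min_eq_right h, min_eq_right (h.trans (Nat.le_succ i))])
    y (by simpa [min_eq_right hs, h0, hfs] using hy)
  refine hfB _ (hB (f (min i s)) ?_)
  have h1 : (G.dist x (f (min i s)) : ℝ) ≤ G.dist x y + G.dist y (f (min i s)) :=
    mod_cast hG.dist_triangle
  have : (G.dist x (f (min i s)) : ℝ) ≤ r := by linarith
  exact_mod_cast this

end Expand

end HyperbolicCut

namespace HyperbolicCut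

open Finset

/-! ### Separation of the confined searches -/

section Disjoint

variable {V : Type*} [Fintype V] {G : SimpleGraph V}

/-- In a hyperbolic graph of large diameter, searches around two distinct positions of a geodesic,
each one confined by two balls, do not meet. -/
theorem disjoint_confined_searches {δ : ℝ} (hG : G.Connected) (h : IsHyperbolic G δ) {γ : ℕ → V}
    {D N r s w : ℕ} (hγ : ∀ i j, i ≤ j → j ≤ D → G.dist (γ i) (γ j) = j - i)
    (hr : δ * (N + 1) ≤ r) (hrw : r < w) (hs : s ≤ 2 ^ N) {i j : ℕ} (hij : i < j)
    (hj : (2 * j + 2) * w ≤ D) {B : ℕ → Finset V}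
    (hB : ∀ i v, v ∈ B i ↔ G.dist (γ (2 * i * w)) v ≤ r ∨ G.dist (γ ((2 * i + 2) * w)) v ≤ r) :
    Disjoint ((expand G (B i))^[s] {γ ((2 * i + 1) * w)})
      ((expand G (B j))^[s] {γ ((2 * j + 1) * w)}) := by
  rw [disjoint_left]
  intro z hzi hzj
  have hδ := nonneg_of_isHyperbolic hG h
  have hδr : δ ≤ r := le_trans (by nlinarith [show (0 : ℝ) ≤ N by positivity]) hr
  have center : ∀ k ≤ j, γ ((2 * k + 1) * w) ∉ B k := by
    intro k hk hmem
    have h1 : (2 * k + 2) * w ≤ D := le_trans (Nat.mul_le_mul_right _ (by omega)) hj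
    rcases (hB _ _).1 hmem with h2 | h2
    · rw [hγ _ _ (by nlinarith) (by nlinarith), ← Nat.sub_mul,
        show 2 * k + 1 - 2 * k = 1 by omega] at h2
      omega
    · rw [SimpleGraph.dist_comm, hγ _ _ (by nlinarith) (by nlinarith), ← Nat.sub_mul,
        show 2 * k + 2 - (2 * k + 1) = 1 by omega] at h2
      omega
  obtain ⟨m, rfl⟩ : ∃ m, j = i + m + 1 := ⟨j - i - 1, by omega⟩
  have e1 : G.dist (γ ((2 * i + 1) * w)) (γ ((2 * i + 2) * w)) = w := by
    rw [hγ _ _ (by nlinarith) (by nlinarith), ← Nat.sub_mul,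
      show 2 * i + 2 - (2 * i + 1) = 1 by omega, one_mul]
  have e2 : G.dist (γ ((2 * i + 2) * w)) (γ ((2 * (i + m + 1) + 1) * w)) = (2 * m + 1) * w := by
    rw [hγ _ _ (by nlinarith) (by nlinarith), ← Nat.sub_mul]
    congr 1; omega
  have e3 : G.dist (γ ((2 * i + 1) * w)) (γ (2 * (i + m + 1) * w)) = (2 * m + 1) * w := by
    rw [hγ _ _ (by nlinarith) (by nlinarith), ← Nat.sub_mul]
    congr 1; omega
  have e4 : G.dist (γ (2 * (i + m + 1) * w)) (γ ((2 * (i + m + 1) + 1) * w)) = w := by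
    rw [hγ _ _ (by nlinarith) (by nlinarith), ← Nat.sub_mul,
      show 2 * (i + m + 1) + 1 - 2 * (i + m + 1) = 1 by omega, one_mul]
  have e5 : G.dist (γ ((2 * i + 1) * w)) (γ ((2 * (i + m + 1) + 1) * w)) = (2 * m + 2) * w := by
    rw [hγ _ _ (by nlinarith) (by nlinarith), ← Nat.sub_mul]
    congr 1; omega
  have b1 : Between G (γ ((2 * i + 1) * w)) (γ ((2 * i + 2) * w))
      (γ ((2 * (i + m + 1) + 1) * w)) := by
    unfold Between; rw [e1, e2, e5]; ring
  have b2 : Between G (γ ((2 * i + 1) * w)) (γ (2 * (i + m + 1) * w))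
      (γ ((2 * (i + m + 1) + 1) * w)) := by
    unfold Between; rw [e3, e4, e5]; ring
  -- In the triangle of the two centers and a common node `z`, the side joining the centers runs
  -- through the right ball center of search `i` and the left ball center of search `j`. The nearby
  -- nodes `y`, `y'` cannot lie on the side of the search that avoids the respective ball, so each
  -- lies on the opposite side.
  obtain ⟨y, hy, hxy⟩ := exists_near_side hG h z b1
  obtain ⟨y', hy', hxy'⟩ := exists_near_side hG h z b2
  have avoid_i := fun {x y} hB' hb => not_near_of_mem_iterate_expand (x := x) (y := y) hG h hr hB'
    (center i (by omega)) hs hzi hb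
  have avoid_j := fun {x y} hB' hb => not_near_of_mem_iterate_expand (x := x) (y := y) hG h hr hB'
    (center (i + m + 1) le_rfl) hs hzj hb
  replace hy := hy.resolve_left fun hb => avoid_i (fun v hv => (hB _ _).2 (Or.inr hv)) hb hxy
  replace hy' := hy'.resolve_right fun hb => avoid_j (fun v hv => (hB _ _).2 (Or.inl hv)) hb hxy'
  -- For neighbouring searches the two ball centers coincide, and both searches avoid that ball.
  rcases Nat.eq_zero_or_pos m with rfl | hm
  · exact avoid_i (fun v hv => (hB _ _).2 (Or.inr hv)) hy' hxy'
  have lt_w : ∀ {u v : V}, (G.dist u v : ℝ) ≤ δ → G.dist u v < w := fun huv =>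
    lt_of_le_of_lt (by exact_mod_cast huv.trans hδr) hrw
  have f1 := lt_w hxy
  have f2 := lt_w hxy'
  unfold Between at hy hy'
  have g1 := hG.dist_triangle (u := γ ((2 * i + 1) * w)) (v := y') (w := γ (2 * (i + m + 1) * w))
  have g2 := hG.dist_triangle (u := γ ((2 * i + 1) * w)) (v := γ ((2 * i + 2) * w)) (w := y)
  have g3 := hG.dist_triangle (u := γ ((2 * i + 1) * w)) (v := y) (w := z)
  have g4 := hG.dist_triangle (u := γ ((2 * i + 2) * w)) (v := y)
    (w := γ ((2 * (i + m + 1) + 1) * w))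
  have g5 := hG.dist_triangle (u := γ ((2 * (i + m + 1) + 1) * w)) (v := γ (2 * (i + m + 1) * w))
    (w := y')
  have g6 := hG.dist_triangle (u := γ ((2 * (i + m + 1) + 1) * w)) (v := y') (w := z)
  rw [SimpleGraph.dist_comm (u := y')] at g1
  rw [SimpleGraph.dist_comm (u := y) (v := γ ((2 * (i + m + 1) + 1) * w))] at g4
  rw [SimpleGraph.dist_comm (u := γ ((2 * (i + m + 1) + 1) * w)) (v := γ (2 * (i + m + 1) * w))]
    at g5
  -- Going via `y`, `z` is farther from the second center than from the first by at least `2mw`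
  -- minus twice the distance of `y` to its ball center. Going via `y'` gives the same with the
  -- centers exchanged. In sum, the two small distances add up to at least `2mw ≥ 2w`, but each is
  -- below `w`.
  have hmw : w ≤ m * w := Nat.le_mul_of_pos_left _ hm
  have hexp : (2 * m + 1) * w = 2 * (m * w) + w := by ring
  omega

end Disjoint

/-! ### Growth of searches and small cuts -/

section Counting

variable {V : Type*} [Fintype V] {G : SimpleGraph V} [DecidableRel G.Adj] {d : ℕ}

theorem vol_eq (hd : G.IsRegularOfDegree d) (U : Finset V) : vol G U = d * U.card := by
  simp [vol, hd.degree_eq, mul_comm]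

variable [DecidableEq V]

/-- Each cut edge is charged to its outer end, which receives at most `d` of them. -/
theorem cutSize_le (hd : G.IsRegularOfDegree d) {U W : Finset V}
    (h : ∀ u ∈ U, ∀ v, v ∉ U → G.Adj u v → v ∈ W) : cutSize G U ≤ d * W.card := by
  have hsub : G.interedges U Uᶜ ⊆ W.biUnion fun w => (G.neighborFinset w).image fun u => (u, w) := by
    rintro ⟨u, v⟩ huv
    obtain ⟨hu, hv, ha⟩ := G.mk_mem_interedges_iff.1 huv
    simp only [mem_biUnion, mem_image, SimpleGraph.mem_neighborFinset]
    exact ⟨v, h u hu v (by simpa using hv) ha, u, ha.symm, rfl⟩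
  refine (card_le_card hsub).trans ((card_biUnion_le_card_mul _ _ d fun w _ => ?_).trans_eq
    (mul_comm _ _))
  exact card_image_le.trans (by simp [hd.degree_eq])

/-- The last two terms of the binomial expansion already suffice: `c ^ c` and `c * c ^ (c - 1)`. -/
theorem two_mul_pow_le {c : ℕ} (hc : 0 < c) : 2 * c ^ c ≤ (c + 1) ^ c := by
  obtain ⟨k, rfl⟩ : ∃ k, c = k + 1 := ⟨c - 1, by omega⟩
  rw [add_pow (k + 1) 1, Finset.sum_range_succ, Finset.sum_range_succ]
  simp only [one_pow, mul_one, Nat.choose_self, Nat.cast_one, Nat.choose_succ_self_right]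
  have : (k + 1) ^ (k + 1) = (k + 1) ^ k * (k + 1) := pow_succ _ _
  push_cast
  omega

/-- Growth by the factor `1 + 1/c` in each round doubles the size every `c` rounds. -/
theorem pow_two_mul_le_of_growth {c T : ℕ} {a : ℕ → ℕ}
    (h : ∀ s < T, (c + 1) * a s ≤ c * a (s + 1)) (hc : 0 < c) (t : ℕ) (ht : c * t ≤ T) :
    2 ^ t * a 0 ≤ a (c * t) := by
  have step : ∀ s j, s + j ≤ T → (c + 1) ^ j * a s ≤ c ^ j * a (s + j) := by
    intro s j
    induction j with
    | zero => simp
    | succ j ih =>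
      intro hj
      calc (c + 1) ^ (j + 1) * a s = (c + 1) * ((c + 1) ^ j * a s) := by ring
        _ ≤ (c + 1) * (c ^ j * a (s + j)) := Nat.mul_le_mul_left _ (ih (by omega))
        _ = c ^ j * ((c + 1) * a (s + j)) := by ring
        _ ≤ c ^ j * (c * a (s + j + 1)) := Nat.mul_le_mul_left _ (h _ (by omega))
        _ = _ := by ring_nf
  induction t with
  | zero => simp
  | succ t ih =>
    have h1 := ih (le_trans (Nat.mul_le_mul_left _ (Nat.le_succ t)) ht)
    have h2 := step (c * t) c (by rw [← Nat.mul_succ]; exact ht)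
    have h3 := Nat.mul_le_mul_right (a (c * t)) (two_mul_pow_le hc)
    have h4 : c ^ c * (2 * a (c * t)) ≤ c ^ c * a (c * t + c) := by
      calc _ = _ := by ring
        _ ≤ _ := h3.trans h2
    have h5 := Nat.le_of_mul_le_mul_left h4 (by positivity)
    rw [Nat.mul_succ]
    calc _ = 2 * (2 ^ t * a 0) := by ring
      _ ≤ _ := by omega

/-- If a search whose forbidden set `B` is small and far away covers few nodes, then one of its
stages has a small cut. -/
theorem exists_small_cut (hd : G.IsRegularOfDegree d) {M t₀ t₁ : ℕ} {B : Finset V} {p : V}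
    (hM : 0 < M) (hB : 2 * M * B.card ≤ 2 ^ t₀) (hcard : Fintype.card V < 2 ^ t₁)
    (hfar : ∀ s, s < 2 * M * t₀ → ∀ u ∈ (expand G B)^[s] {p}, ∀ v ∈ B, ¬ G.Adj u v) :
    ∃ s < 2 * M * t₁,
      M * cutSize G ((expand G B)^[s] {p}) ≤ vol G ((expand G B)^[s] {p}) := by
  by_contra! hcon
  set U : ℕ → Finset V := fun s => (expand G B)^[s] {p} with hU
  have hmono : ∀ s, U s ⊆ U (s + 1) := fun s => iterate_expand_mono (Nat.le_succ s)
  have hsucc : ∀ s, ∀ u ∈ U s, ∀ v, v ∉ B → G.Adj u v → v ∈ U (s + 1) := by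
    intro s u hu v hv ha
    rw [hU]
    simp only [Function.iterate_succ_apply']
    exact mem_expand.2 (Or.inr ⟨hv, u, hu, ha⟩)
  have hsd : ∀ s, (U (s + 1) \ U s).card + (U s).card = (U (s + 1)).card := fun s =>
    card_sdiff_add_card_eq_card (hmono s)
  have hpos : ∀ s W, s < 2 * M * t₁ → cutSize G (U s) ≤ d * W → (U s).card < M * W := by
    intro s W hs hW
    have h1 := hcon s hs
    rw [vol_eq hd] at h1
    have h2 : d * (U s).card < d * (M * W) :=
      lt_of_lt_of_le h1 ((Nat.mul_le_mul_left _ hW).trans_eq (by ring))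
    exact Nat.lt_of_mul_lt_mul_left h2
  -- Early on, no edge leads into `B`, so every outer end of a cut edge is a new node of the next
  -- stage.
  have phase₁ : ∀ s, s < 2 * M * t₀ → s < 2 * M * t₁ →
      (2 * M + 1) * (U s).card ≤ 2 * M * (U (s + 1)).card := by
    intro s hs hs₁
    have h1 := hpos s _ hs₁ (cutSize_le hd (W := U (s + 1) \ U s) fun u hu v hv ha =>
      mem_sdiff.2 ⟨hsucc s u hu v (fun hvB => hfar s hs u hu v hvB ha) ha, hv⟩)
    rw [← hsd s]
    nlinarith
  have a0 : (U 0).card = 1 := by simp [hU]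
  -- Later, outer ends may also lie in `B`. By then the stage has at least `2 ^ t₀ ≥ 2M|B|` nodes,
  -- so `B` accounts for at most half of the bound `M(new + |B|)`; this is why the growth rate is
  -- `1/(2M)` and not `1/M`.
  have phase₂ : ∀ s, 2 * M * t₀ ≤ s → s < 2 * M * t₁ →
      (2 * M + 1) * (U s).card ≤ 2 * M * (U (s + 1)).card := by
    intro s hs hs₁
    have h1 := hpos s ((U (s + 1) \ U s).card + B.card) hs₁
      ((cutSize_le hd (W := (U (s + 1) \ U s) ∪ B) fun u hu v hv ha => by
        by_cases hvB : v ∈ B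
        · exact mem_union_right _ hvB
        · exact mem_union_left _ (mem_sdiff.2 ⟨hsucc s u hu v hvB ha, hv⟩)).trans
        (Nat.mul_le_mul_left _ (card_union_le _ _)))
    have h2 := pow_two_mul_le_of_growth (a := fun s => (U s).card) (T := 2 * M * t₀) (c := 2 * M)
      (fun s hs' => phase₁ s hs' (by omega)) (by omega) t₀ le_rfl
    have h3 : (U (2 * M * t₀)).card ≤ (U s).card := card_le_card (iterate_expand_mono hs)
    rw [← hsd s]
    simp only [a0, mul_one] at h2
    nlinarith
  have h1 := pow_two_mul_le_of_growth (a := fun s => (U s).card) (T := 2 * M * t₁) (c := 2 * M)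
    (fun s hs => (lt_or_ge s (2 * M * t₀)).elim (fun h => phase₁ s h hs) fun h => phase₂ s h hs)
    (by omega) t₁ le_rfl
  have h2 := card_le_univ (U (2 * M * t₁))
  simp only [a0, mul_one] at h1
  omega

/-- Confined searches find a small set with a small cut. -/
theorem exists_small_set_small_cut {δ : ℝ} (hG : G.Connected) (hd : G.IsRegularOfDegree d)
    (h : IsHyperbolic G δ) {K M N r t₀ t₁ w : ℕ} (hK : 0 < K) (hM : 0 < M)
    (hr : δ * (N + 1) ≤ r) (ht₀ : 4 * M * (d + 1) ^ r ≤ 2 ^ t₀)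
    (ht₁ : Fintype.card V < 2 ^ t₁) (hT : 2 * M * t₁ ≤ 2 ^ N) (hTn : 2 * M * t₁ ≤ Fintype.card V)
    (hw : 2 * M * t₀ + r < w) (hD : (d + 1) ^ (2 * K * w) < Fintype.card V) :
    ∃ x y p, ∃ r < Fintype.card V, ∃ s < Fintype.card V, ∃ U : Finset V,
      U = (expand G ((expand G ∅)^[r] {x, y}))^[s] {p} ∧
      K * U.card ≤ Fintype.card V ∧ M * cutSize G U ≤ vol G U := by
  obtain ⟨a, b, hab⟩ := exists_lt_dist hG (fun v => (hd.degree_eq v).le) hD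
  obtain ⟨γ, hγ⟩ := exists_geodesic_seq hG a b
  have hrn : r < Fintype.card V := by
    have := dist_lt_card hG a b
    nlinarith
  set B : ℕ → Finset V := fun i => (expand G ∅)^[r] {γ (2 * i * w), γ ((2 * i + 2) * w)} with hBdef
  have hB : ∀ i v, v ∈ B i ↔
      G.dist (γ (2 * i * w)) v ≤ r ∨ G.dist (γ ((2 * i + 2) * w)) v ≤ r := by
    intro i v
    constructor
    · intro hv
      obtain ⟨u, hu, huv⟩ := exists_dist_le_of_mem_iterate_expand hG hv
      simp only [mem_insert, mem_singleton] at hu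
      rcases hu with rfl | rfl
      · exact Or.inl huv
      · exact Or.inr huv
    · rintro (hv | hv)
      · exact mem_iterate_expand_of_dist_le hG (by simp) hv
      · exact mem_iterate_expand_of_dist_le hG (by simp) hv
  have hend : ∀ i < K, (2 * i + 2) * w ≤ G.dist a b := fun i hi =>
    le_trans (Nat.mul_le_mul_right w (by omega)) hab.le
  -- Averaging over `K` disjoint searches, taken at their final stage; earlier stages are subsets of
  -- it.
  obtain ⟨i, hiK, hi⟩ : ∃ i < K,
      K * ((expand G (B i))^[2 * M * t₁] {γ ((2 * i + 1) * w)}).card ≤ Fintype.card V := by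
    by_contra! hcon
    have hdisj : ((range K : Finset ℕ) : Set ℕ).PairwiseDisjoint
        fun i => (expand G (B i))^[2 * M * t₁] {γ ((2 * i + 1) * w)} := by
      intro i hi j hj hne
      simp only [coe_range, Set.mem_Iio] at hi hj
      rcases lt_or_gt_of_ne hne with hlt | hlt
      · exact disjoint_confined_searches hG h hγ hr (by omega) hT hlt (hend _ hj) hB
      · exact (disjoint_confined_searches hG h hγ hr (by omega) hT hlt (hend _ hi) hB).symm
    have h1 := card_le_univ ((range K).biUnion
      fun i => (expand G (B i))^[2 * M * t₁] {γ ((2 * i + 1) * w)})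
    rw [card_biUnion hdisj] at h1
    have h2 : ∑ i ∈ range K, Fintype.card V <
        ∑ i ∈ range K, K * ((expand G (B i))^[2 * M * t₁] {γ ((2 * i + 1) * w)}).card :=
      sum_lt_sum_of_nonempty ⟨0, by simpa using hK⟩ fun i hi => hcon i (by simpa using hi)
    rw [← mul_sum] at h2
    simp only [sum_const, card_range, smul_eq_mul] at h2
    exact absurd h1 (not_le.2 (Nat.lt_of_mul_lt_mul_left h2))
  have hBcard : 2 * M * (B i).card ≤ 2 ^ t₀ := by
    have h1 := card_iterate_expand_le (G := G) (B := ∅)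
      (S := {γ (2 * i * w), γ ((2 * i + 2) * w)}) (fun v => (hd.degree_eq v).le) r
    have h2 := h1.trans (Nat.mul_le_mul_left _ card_le_two)
    calc _ ≤ 2 * M * ((d + 1) ^ r * 2) := Nat.mul_le_mul_left _ h2
      _ = 4 * M * (d + 1) ^ r := by ring
      _ ≤ _ := ht₀
  -- An edge from stage `s < 2Mt₀` into a ball would put the center within `r + s + 1 < w` of a ball
  -- center, but these are at distance exactly `w`.
  obtain ⟨s, hs, hcut⟩ := exists_small_cut hd hM hBcard ht₁
    (p := γ ((2 * i + 1) * w)) (by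
      intro s hs u hu v hv ha
      obtain ⟨p, hp, hpu⟩ := exists_dist_le_of_mem_iterate_expand hG hu
      rw [mem_singleton] at hp
      subst hp
      have h0 := hend i hiK
      have h1 : G.dist (γ (2 * i * w)) (γ ((2 * i + 1) * w)) = w := by
        rw [hγ _ _ (by nlinarith) (by nlinarith), ← Nat.sub_mul,
          show 2 * i + 1 - 2 * i = 1 by omega, one_mul]
      have h2 : G.dist (γ ((2 * i + 2) * w)) (γ ((2 * i + 1) * w)) = w := by
        rw [SimpleGraph.dist_comm, hγ _ _ (by nlinarith) (by nlinarith), ← Nat.sub_mul,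
          show 2 * i + 2 - (2 * i + 1) = 1 by omega, one_mul]
      have h3 := SimpleGraph.dist_eq_one_iff_adj.2 ha
      have h4 := hG.dist_triangle (u := γ ((2 * i + 1) * w)) (v := u) (w := v)
      have h5 : ∀ x, G.dist x v ≤ r → G.dist x (γ ((2 * i + 1) * w)) ≤ r + s + 1 := by
        intro x hx
        have := hG.dist_triangle (u := x) (v := v) (w := γ ((2 * i + 1) * w))
        rw [SimpleGraph.dist_comm (u := v)] at this
        omega
      rcases (hB i v).1 hv with hv | hv
      · have := h5 _ hv; omega
      · have := h5 _ hv; omega)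
  refine ⟨_, _, _, r, hrn, s, by omega, _, rfl, le_trans (Nat.mul_le_mul_left _ ?_) hi, hcut⟩
  exact card_le_card (iterate_expand_mono hs.le)

end Counting

end HyperbolicCut

/-! ### Asymptotic choice of the parameters -/

namespace HyperbolicCut

open Filter

/-- Applied to `x = log n`: the exponential bound makes `2 ^ N` exceed the number of rounds, the
power bound leaves room for the geodesic. -/
theorem eventually_real_bounds {ρ : ℝ} (h0 : 0 < ρ) (c C : ℝ) :
    ∀ᶠ x : ℝ in atTop, 1 ≤ x ∧ c * (x + 1) ≤ (2 : ℝ) ^ (x ^ (ρ / 2)) ∧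
      C * x ^ (2 / 3 - ρ / 2) < x := by
  have hpow : Tendsto (fun x : ℝ => x ^ (ρ / 2)) atTop atTop := tendsto_rpow_atTop (by linarith)
  have hexp : Tendsto (fun y : ℝ => y ^ (2 / ρ) / Real.exp (Real.log 2 * y)) atTop (nhds 0) := by
    have := tendsto_rpow_mul_exp_neg_mul_atTop_nhds_zero (2 / ρ) (Real.log 2)
      (Real.log_pos (by norm_num))
    refine this.congr fun y => ?_
    rw [neg_mul, Real.exp_neg, ← div_eq_mul_inv]
  -- For `x ≥ 1`, `c (x + 1) ≤ 2 |c| x`, which explains the constant.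
  have h2 : ∀ᶠ x : ℝ in atTop, x / (2 : ℝ) ^ (x ^ (ρ / 2)) < 1 / (2 * (|c| + 1)) := by
    have := (hexp.comp hpow).eventually (gt_mem_nhds (show (0 : ℝ) < 1 / (2 * (|c| + 1)) by
      positivity))
    filter_upwards [this, eventually_ge_atTop 1] with x hx hx1
    rw [Real.rpow_def_of_pos (by norm_num : (0 : ℝ) < 2)]
    simp only [Function.comp] at hx
    rwa [← Real.rpow_mul (by linarith), show ρ / 2 * (2 / ρ) = 1 by field_simp,
      Real.rpow_one] at hx
  have h3 : ∀ᶠ x : ℝ in atTop, |C| < x ^ (1 / 3 + ρ / 2) :=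
    (tendsto_rpow_atTop (by linarith)).eventually_gt_atTop _
  filter_upwards [h2, h3, eventually_ge_atTop 1] with x h2 h3 h1
  refine ⟨h1, ?_, ?_⟩
  · have hp : (0 : ℝ) < (2 : ℝ) ^ (x ^ (ρ / 2)) := by positivity
    rw [div_lt_div_iff₀ hp (by positivity)] at h2
    have := le_abs_self c
    nlinarith [abs_nonneg c]
  · have hx : (0 : ℝ) < x := by linarith
    have e : x = x ^ (1 / 3 + ρ / 2) * x ^ (2 / 3 - ρ / 2) := by
      rw [← Real.rpow_add hx]; norm_num
    have hp : (0 : ℝ) < x ^ (2 / 3 - ρ / 2) := by positivity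
    calc C * x ^ (2 / 3 - ρ / 2) ≤ |C| * x ^ (2 / 3 - ρ / 2) :=
          mul_le_mul_of_nonneg_right (le_abs_self C) hp.le
      _ < x ^ (1 / 3 + ρ / 2) * x ^ (2 / 3 - ρ / 2) := mul_lt_mul_of_pos_right h3 hp
      _ = x := e.symm

/-- Parameters for `exists_small_set_small_cut` exist in all large graphs whose degree and
hyperbolicity are suitably bounded. -/
theorem exists_search_parameters {ρ : ℝ} (h0 : 0 < ρ) (h1 : ρ < 1 / 3) (K M : ℕ) :
    ∃ n₀ : ℕ, ∀ n ≥ n₀, ∀ d : ℕ, (d : ℝ) ≤ (2 : ℝ) ^ ((Real.logb 2 n) ^ (1 / 3 - ρ)) →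
      ∃ N r t₀ t₁ w : ℕ, (Real.logb 2 n) ^ ρ * (N + 1) ≤ r ∧ 4 * M * (d + 1) ^ r ≤ 2 ^ t₀ ∧
        n < 2 ^ t₁ ∧ 2 * M * t₁ ≤ 2 ^ N ∧ 2 * M * t₁ ≤ n ∧ 2 * M * t₀ + r < w ∧
        (d + 1) ^ (2 * K * w) < n := by
  have hlog : Tendsto (fun n : ℕ => Real.logb 2 n) atTop atTop :=
    (Real.tendsto_logb_atTop (by norm_num)).comp tendsto_natCast_atTop_atTop
  obtain ⟨n₀, hn₀⟩ := eventually_atTop.1 (hlog.eventually (eventually_real_bounds h0 (2 * M)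
    (72 * K * (2 * M * (1 + 4 * M) + 2))))
  refine ⟨n₀ + 1, fun n hn d hd => ?_⟩
  obtain ⟨hL, hexp, hsmall⟩ := hn₀ n (by omega)
  have hn0 : (0 : ℝ) < n := by exact_mod_cast (by omega : 0 < n)
  have hnL : (2 : ℝ) ^ Real.logb 2 n = n := Real.rpow_logb (by norm_num) (by norm_num) hn0
  generalize Real.logb 2 n = L at *
  have hL0 : 0 < L := by linarith
  have one_le : ∀ {e : ℝ}, 0 ≤ e → 1 ≤ L ^ e := fun he => Real.one_le_rpow hL he
  set x := L ^ (1 / 3 - ρ)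
  have hx : 1 ≤ x := one_le (by linarith)
  have hy : 1 ≤ L ^ (ρ / 2) := one_le (by linarith)
  have hz : 1 ≤ L ^ ρ := one_le h0.le
  set N := ⌈L ^ (ρ / 2)⌉₊ with hN
  have hN1 : L ^ (ρ / 2) ≤ N := Nat.le_ceil _
  have hN2 : (N : ℝ) < L ^ (ρ / 2) + 1 := Nat.ceil_lt_add_one (by linarith)
  set r := ⌈L ^ ρ * (N + 1)⌉₊ with hr
  have hr1 : L ^ ρ * (N + 1) ≤ r := Nat.le_ceil _
  have hr2 : (r : ℝ) < L ^ ρ * (N + 1) + 1 := Nat.ceil_lt_add_one (by positivity)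
  -- The extra `1` absorbs the step from `d` to `d + 1`: `2^x + 1 ≤ 2^(x+1)`.
  set b := ⌈x⌉₊ + 1 with hb
  have hb1 : x + 1 ≤ b := by rw [hb]; push_cast; linarith [Nat.le_ceil x]
  have hb2 : (b : ℝ) ≤ 3 * x := by
    rw [hb]; push_cast; linarith [Nat.ceil_lt_add_one (show 0 ≤ x by linarith)]
  have hyz : 1 ≤ L ^ ρ * L ^ (ρ / 2) := one_le_mul_of_one_le_of_one_le hz hy
  have hr3 : (r : ℝ) ≤ 4 * (L ^ ρ * L ^ (ρ / 2)) := by nlinarith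
  have hr4 : (1 : ℝ) ≤ r := le_trans (by nlinarith [show (0 : ℝ) ≤ N by positivity]) hr1
  have hb3 : (1 : ℝ) ≤ b := by linarith
  have hdb : d + 1 ≤ 2 ^ b := by
    have : (d : ℝ) + 1 ≤ 2 ^ b := by
      calc (d : ℝ) + 1 ≤ 2 ^ x + 2 ^ x :=
            add_le_add hd (Real.one_le_rpow (by norm_num) (by linarith))
        _ = (2 : ℝ) ^ (x + 1) := by rw [Real.rpow_add_one (by norm_num)]; ring
        _ ≤ (2 : ℝ) ^ (b : ℝ) := Real.rpow_le_rpow_of_exponent_le (by norm_num) hb1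
        _ = _ := Real.rpow_natCast _ _
    exact_mod_cast this
  have ht₁ : ((⌊L⌋₊ + 1 : ℕ) : ℝ) ≤ L + 1 := by
    push_cast; linarith [Nat.floor_le hL0.le]
  have hexp' : 2 * (M : ℝ) * ((⌊L⌋₊ + 1 : ℕ) : ℝ) ≤ (2 : ℝ) ^ (L ^ (ρ / 2)) :=
    le_trans (mul_le_mul_of_nonneg_left ht₁ (by positivity)) hexp
  -- In `t₀`, `r * b` pays for `(d + 1) ^ r` and `4 * M` for the factor `4 * M ≤ 2 ^ (4 * M)`.
  refine ⟨N, r, r * b + 4 * M, ⌊L⌋₊ + 1, 2 * M * (r * b + 4 * M) + r + 1, hr1, ?_, ?_, ?_, ?_,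
    Nat.lt_succ_self _, ?_⟩
  · calc 4 * M * (d + 1) ^ r ≤ 2 ^ (4 * M) * (2 ^ b) ^ r :=
          Nat.mul_le_mul Nat.lt_two_pow_self.le (Nat.pow_le_pow_left hdb r)
      _ = _ := by rw [← pow_mul, ← pow_add]; congr 1; ring
  · have : (n : ℝ) < 2 ^ (⌊L⌋₊ + 1) := by
      rw [← hnL, ← Real.rpow_natCast]
      refine Real.rpow_lt_rpow_of_exponent_lt (by norm_num) ?_
      push_cast
      exact Nat.lt_floor_add_one L
    exact_mod_cast this
  · have : 2 * (M : ℝ) * ((⌊L⌋₊ + 1 : ℕ) : ℝ) ≤ 2 ^ N := by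
      refine hexp'.trans ?_
      rw [← Real.rpow_natCast]
      exact Real.rpow_le_rpow_of_exponent_le (by norm_num) hN1
    exact_mod_cast this
  · have : 2 * (M : ℝ) * ((⌊L⌋₊ + 1 : ℕ) : ℝ) ≤ n := by
      refine hexp'.trans ?_
      rw [← hnL]
      refine Real.rpow_le_rpow_of_exponent_le (by norm_num) ?_
      calc L ^ (ρ / 2) ≤ L ^ (1 : ℝ) := Real.rpow_le_rpow_of_exponent_le hL (by linarith)
        _ = L := Real.rpow_one L
    exact_mod_cast this
  · set w := 2 * M * (r * b + 4 * M) + r + 1 with hw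
    have hrb : (1 : ℝ) ≤ r * b := one_le_mul_of_one_le_of_one_le hr4 hb3
    have hrb' : (r : ℝ) ≤ r * b := le_mul_of_one_le_right (by linarith) hb3
    have hwb : (w : ℝ) ≤ (2 * M * (1 + 4 * M) + 2) * (r * b) := by
      rw [hw]; push_cast
      have : (M : ℝ) * M ≤ M * M * (r * b) := le_mul_of_one_le_right (by positivity) hrb
      nlinarith
    have hpow : L ^ ρ * L ^ (ρ / 2) * (x * x) = L ^ (2 / 3 - ρ / 2) := by
      simp only [x]
      rw [← Real.rpow_add hL0, ← Real.rpow_add hL0, ← Real.rpow_add hL0]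
      congr 1; ring
    have hbb : (b : ℝ) * b ≤ 9 * (x * x) := by nlinarith
    -- The constant `72` is `2 · 4 · 9`, from `r ≤ 4 L^(3ρ/2)` and `b² ≤ 9x²`. The exponents add up
    -- as `3ρ/2 + 2(1/3 - ρ) = 2/3 - ρ/2`.
    have hlt : (b : ℝ) * (2 * K * w) < L := by
      refine lt_of_le_of_lt ?_ hsmall
      calc (b : ℝ) * (2 * K * w) ≤ b * (2 * K * ((2 * M * (1 + 4 * M) + 2) * (r * b))) := by
            gcongr
        _ = 2 * K * (2 * M * (1 + 4 * M) + 2) * (r * (b * b)) := by ring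
        _ ≤ 2 * K * (2 * M * (1 + 4 * M) + 2) * (4 * (L ^ ρ * L ^ (ρ / 2)) * (9 * (x * x))) := by
            gcongr
        _ = 72 * K * (2 * M * (1 + 4 * M) + 2) * (L ^ ρ * L ^ (ρ / 2) * (x * x)) := by ring
        _ = _ := by rw [hpow]
    have : ((d : ℝ) + 1) ^ (2 * K * w) < n := by
      calc ((d : ℝ) + 1) ^ (2 * K * w) ≤ ((2 : ℝ) ^ b) ^ (2 * K * w) :=
            pow_le_pow_left₀ (by positivity) (by exact_mod_cast hdb) _
        _ = (2 : ℝ) ^ ((b : ℝ) * (2 * K * w)) := by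
            rw [← pow_mul, ← Real.rpow_natCast]; push_cast; rfl
        _ < (2 : ℝ) ^ L := Real.rpow_lt_rpow_of_exponent_lt (by norm_num) hlt
        _ = n := hnL
    exact_mod_cast this

end HyperbolicCut

namespace RAM

open Finset

/-! ### Timed total correctness -/

/-- Started in `s`, the program `p` halts within `T` steps in a state that satisfies `Q`. -/
def Does (p : Program) (T : ℕ) (s : State) (Q : State → Prop) : Prop :=
  ∃ t s', Exec p s t s' ∧ t ≤ T ∧ Q s'

/-- The registers that a program may change. -/
def Program.regs : Program → Finset ℕ
  | .skip => ∅
  | .assign x _ => {x}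
  | .store _ _ _ => ∅
  | .seq p q => p.regs ∪ q.regs
  | .ite _ p q => p.regs ∪ q.regs
  | .loop _ p => p.regs

/-- The arrays that a program may change. -/
def Program.arrs : Program → Finset ℕ
  | .skip => ∅
  | .assign _ _ => ∅
  | .store a _ _ => {a}
  | .seq p q => p.arrs ∪ q.arrs
  | .ite _ p q => p.arrs ∪ q.arrs
  | .loop _ p => p.arrs

theorem Exec.reg_eq {p : Program} {s s' : State} {t : ℕ} (h : Exec p s t s') {x : ℕ}
    (hx : x ∉ p.regs) : s'.reg x = s.reg x := by
  induction h with
  | skip => rfl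
  | assign y e s => exact Function.update_of_ne (by simpa [Program.regs] using hx) _ _
  | store => rfl
  | seq _ _ ih₁ ih₂ =>
    simp only [Program.regs, mem_union, not_or] at hx
    rw [ih₂ hx.2, ih₁ hx.1]
  | ite_true _ _ ih =>
    simp only [Program.regs, mem_union, not_or] at hx
    exact ih hx.1
  | ite_false _ _ ih =>
    simp only [Program.regs, mem_union, not_or] at hx
    exact ih hx.2
  | loop_done => rfl
  | loop_step _ _ _ ih₁ ih₂ => rw [ih₂ hx, ih₁ hx]

theorem Exec.arr_eq {p : Program} {s s' : State} {t : ℕ} (h : Exec p s t s') {a : ℕ}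
    (ha : a ∉ p.arrs) : s'.arr a = s.arr a := by
  induction h with
  | skip => rfl
  | assign => rfl
  | store b i e s => exact Function.update_of_ne (by simpa [Program.arrs] using ha) _ _
  | seq _ _ ih₁ ih₂ =>
    simp only [Program.arrs, mem_union, not_or] at ha
    rw [ih₂ ha.2, ih₁ ha.1]
  | ite_true _ _ ih =>
    simp only [Program.arrs, mem_union, not_or] at ha
    exact ih ha.1
  | ite_false _ _ ih =>
    simp only [Program.arrs, mem_union, not_or] at ha
    exact ih ha.2
  | loop_done => rfl
  | loop_step _ _ _ ih₁ ih₂ => rw [ih₂ ha, ih₁ ha]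

section Rules

variable {p q : Program} {s : State} {T T' : ℕ} {Q R : State → Prop}

theorem Does.mono (h : Does p T s Q) (hT : T ≤ T') (hQ : ∀ s', Q s' → R s') : Does p T' s R := by
  obtain ⟨t, s', h, ht, hs⟩ := h
  exact ⟨t, s', h, ht.trans hT, hQ s' hs⟩

theorem Does.seq (h : Does p T s R) (h' : ∀ s', R s' → Does q T' s' Q) :
    Does (.seq p q) (T + T') s Q := by
  obtain ⟨t, s', h₁, ht, hs⟩ := h
  obtain ⟨t', s'', h₂, ht', hs'⟩ := h' s' hs
  exact ⟨t + t', s'', .seq h₁ h₂, by omega, hs'⟩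

theorem does_skip (h : Q s) : Does .skip 1 s Q := ⟨1, s, .skip s, le_rfl, h⟩

theorem does_assign (x : ℕ) (e : Expr) (h : Q ⟨Function.update s.reg x (e.eval s), s.arr⟩) :
    Does (.assign x e) (e.cost + 1) s Q :=
  ⟨_, _, .assign x e s, le_rfl, h⟩

theorem does_store (a : ℕ) (i e : Expr)
    (h : Q ⟨s.reg, Function.update s.arr a (Function.update (s.arr a) (i.eval s) (e.eval s))⟩) :
    Does (.store a i e) (i.cost + e.cost + 1) s Q :=
  ⟨_, _, .store a i e s, le_rfl, h⟩

/-- The sum of the two time bounds replaces their maximum, so that all bounds remain polynomial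
expressions. -/
theorem does_ite (e : Expr) (h₁ : e.eval s ≠ 0 → Does p T s Q) (h₂ : e.eval s = 0 → Does q T' s Q) :
    Does (.ite e p q) (e.cost + 1 + (T + T')) s Q := by
  by_cases he : e.eval s = 0
  · obtain ⟨t, s', h, ht, hs⟩ := h₂ he
    exact ⟨_, s', .ite_false he h, by omega, hs⟩
  · obtain ⟨t, s', h, ht, hs⟩ := h₁ he
    exact ⟨_, s', .ite_true he h, by omega, hs⟩

/-- The two states agree on all registers outside `X` and all arrays outside `A`. -/
structure Agree (X A : Finset ℕ) (s s' : State) : Prop where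
  reg : ∀ x ∉ X, s'.reg x = s.reg x
  arr : ∀ a ∉ A, s'.arr a = s.arr a

theorem Agree.trans {X A : Finset ℕ} {s s' s'' : State} (h : Agree X A s s')
    (h' : Agree X A s' s'') : Agree X A s s'' :=
  ⟨fun x hx => (h'.reg x hx).trans (h.reg x hx), fun a ha => (h'.arr a ha).trans (h.arr a ha)⟩

theorem Agree.mono {X X' A A' : Finset ℕ} {s s' : State} (h : Agree X A s s') (hX : X ⊆ X')
    (hA : A ⊆ A') : Agree X' A' s s' :=
  ⟨fun x hx => h.reg x fun h => hx (hX h), fun a ha => h.arr a fun h => ha (hA h)⟩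

theorem agree_update {X A : Finset ℕ} {x : ℕ} (hx : x ∈ X) (s : State) (m : ℕ) :
    Agree X A s ⟨Function.update s.reg x m, s.arr⟩ :=
  ⟨fun y hy => Function.update_of_ne (fun h : y = x => hy (h.symm ▸ hx)) _ _, fun _ _ => rfl⟩

/-- Frame rule: what a program cannot write is preserved, so specifications need only mention what
changes. -/
theorem Does.frame (h : Does p T s Q) :
    Does p T s fun s' => Q s' ∧ Agree p.regs p.arrs s s' := by
  obtain ⟨t, s', h, ht, hQ⟩ := h
  exact ⟨t, s', h, ht, hQ, fun _ => h.reg_eq, fun _ => h.arr_eq⟩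

/-- Counting from `0` to the number in register `0`. -/
def forLoop (c : ℕ) (body : Program) : Program :=
  .seq (.assign c (.const 0))
    (.loop (.sub (.reg 0) (.reg c)) (.seq body (.assign c (.add (.reg c) (.const 1)))))

@[simp] theorem regs_forLoop (c : ℕ) (p : Program) : (forLoop c p).regs = insert c p.regs := by
  ext; simp [forLoop, Program.regs]

@[simp] theorem arrs_forLoop (c : ℕ) (p : Program) : (forLoop c p).arrs = p.arrs := by
  simp [forLoop, Program.arrs]

/-- The invariant must ignore the counter, which is advanced after the body. Guard and increment
cost `4` each, hence `T + 8`; the additional round pays for initialization and the last guard. -/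
theorem does_forLoop {c n : ℕ} {body : Program} (Inv : ℕ → State → Prop) (hc : c ≠ 0)
    (hcb : c ∉ body.regs) (h0b : 0 ∉ body.regs)
    (hInv : ∀ k s m, Inv k s → Inv k ⟨Function.update s.reg c m, s.arr⟩)
    (hn : s.reg 0 = n) (hs : Inv 0 s)
    (hbody : ∀ k < n, ∀ s', s'.reg c = k → Agree (insert c body.regs) body.arrs s s' → Inv k s' →
      Does body T s' (Inv (k + 1))) :
    Does (forLoop c body) ((n + 1) * (T + 8)) s (Inv n) := by
  have main : ∀ j k s', k + j = n → s'.reg c = k → Agree (insert c body.regs) body.arrs s s' →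
      Inv k s' →
      Does (.loop (.sub (.reg 0) (.reg c)) (.seq body (.assign c (.add (.reg c) (.const 1)))))
        (j * (T + 8) + 4) s' (Inv n) := by
    intro j
    induction j with
    | zero =>
      intro k s' hk hcs hA hI
      obtain rfl : k = n := by omega
      have h0 : s'.reg 0 = k := by rw [hA.reg 0 (by simp [hc.symm, h0b]), hn]
      exact ⟨_, s', .loop_done (by simp [Expr.eval, hcs, h0]), by simp [Expr.cost], hI⟩
    | succ j ih =>
      intro k s' hk hcs hA hI
      have h0 : s'.reg 0 = n := by rw [hA.reg 0 (by simp [hc.symm, h0b]), hn]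
      obtain ⟨t₁, s₁, e₁, ht₁, hI₁, hA₁⟩ := (hbody k (by omega) s' hcs hA hI).frame
      obtain ⟨t₂, s₂, e₂, ht₂, hI₂⟩ := ih (k + 1)
        ⟨Function.update s₁.reg c (k + 1), s₁.arr⟩ (by omega) (by simp)
        ((hA.trans (hA₁.mono (subset_insert _ _) subset_rfl)).trans
          (agree_update (mem_insert_self _ _) _ _)) (hInv _ _ _ hI₁)
      refine ⟨_, s₂, .loop_step (t' := t₂) (by simp only [Expr.eval, hcs, h0]; omega)
        (.seq e₁ (.assign _ _ _)) ?_, ?_, hI₂⟩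
      · simpa [Expr.eval, hA₁.reg c hcb, hcs] using e₂
      · simp only [Expr.cost]
        have : (j + 1) * (T + 8) = j * (T + 8) + (T + 8) := by ring
        omega
  have h := (does_assign (s := s) c (.const 0)
    (Q := fun s' => s' = ⟨Function.update s.reg c 0, s.arr⟩) rfl).seq fun s' hs' =>
      main n 0 s' (by omega) (by simp [hs']) (hs' ▸ agree_update (mem_insert_self _ _) _ _)
        (hs' ▸ hInv 0 s 0 hs)
  refine h.mono ?_ fun _ h => h
  simp only [Expr.cost]
  have : (n + 1) * (T + 8) = n * (T + 8) + T + 8 := by ring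
  omega

/-- Indexing the invariant by the set of visited nodes hides the order of the visits. -/
theorem does_vertexLoop {c n : ℕ} {body : Program} (Inv : Finset (Fin n) → State → Prop)
    (hc : c ≠ 0) (hcb : c ∉ body.regs) (h0b : 0 ∉ body.regs)
    (hInv : ∀ A s m, Inv A s → Inv A ⟨Function.update s.reg c m, s.arr⟩)
    (hn : s.reg 0 = n) (hs : Inv ∅ s)
    (hbody : ∀ A, ∀ v : Fin n, v ∉ A → ∀ s', s'.reg c = (v : ℕ) → Agree (insert c body.regs) body.arrs s s' →
      Inv A s' → Does body T s' (Inv (insert v A))) :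
    Does (forLoop c body) ((n + 1) * (T + 8)) s (Inv univ) := by
  have h := does_forLoop (T := T) (s := s) (fun k s => Inv (univ.filter fun v : Fin n => (v : ℕ) < k) s)
    hc hcb h0b (fun k => hInv _) hn (by simpa using hs) (fun k hk s' hcs hA hI => by
      have e : (univ.filter fun v : Fin n => (v : ℕ) < k + 1) =
          insert ⟨k, hk⟩ (univ.filter fun v : Fin n => (v : ℕ) < k) := by
        ext v
        simp only [mem_filter, mem_univ, true_and, mem_insert, Fin.ext_iff]
        omega
      rw [e]
      exact hbody _ ⟨k, hk⟩ (by simp) s' hcs hA hI)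
  simpa using h

/-- Running `body` for all pairs of adjacent nodes, which are held in the registers `1` and `2`. -/
def pairLoop (body : Program) : Program :=
  .seq (.assign 3 (.const 0)) (forLoop 1 (forLoop 2
    (.seq (.ite (.get 0 (.reg 3)) body .skip) (.assign 3 (.add (.reg 3) (.const 1))))))

@[simp] theorem regs_pairLoop (p : Program) :
    (pairLoop p).regs = insert 1 (insert 2 (insert 3 p.regs)) := by
  ext; simp [pairLoop, Program.regs]

@[simp] theorem arrs_pairLoop (p : Program) : (pairLoop p).arrs = p.arrs := by
  ext; simp [pairLoop, Program.arrs]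

theorem mul_add_inj {n : ℕ} {i j i' j' : Fin n} (h : (i : ℕ) * n + j = i' * n + j') :
    i = i' ∧ j = j' := by
  have hn : 0 < n := i.pos
  have h1 := congrArg (· / n) h
  have h2 := congrArg (· % n) h
  simp only [Nat.mul_add_mod_self_right, Nat.mod_eq_of_lt j.2, Nat.mod_eq_of_lt j'.2] at h2
  rw [add_comm, add_comm _ (j' : ℕ)] at h1
  simp only [Nat.add_mul_div_right _ _ hn, Nat.div_eq_of_lt j.2, Nat.div_eq_of_lt j'.2] at h1
  exact ⟨Fin.ext (by omega), Fin.ext h2⟩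

/-- Array `0` holds the adjacency matrix of `G` and register `0` the number of nodes; array `5` is
empty. -/
structure Holds {n : ℕ} (G : SimpleGraph (Fin n)) (s : State) : Prop where
  size : s.reg 0 = n
  adj : ∀ i j : Fin n, s.arr 0 (i * n + j) ≠ 0 ↔ G.Adj i j
  empty : ∀ k, s.arr 5 k = 0

theorem Holds.agree {n : ℕ} {G : SimpleGraph (Fin n)} {s s' : State} (h : Holds G s)
    {X A : Finset ℕ} (hA : Agree X A s s') (hX : 0 ∉ X) (h0 : 0 ∉ A) (h5 : 5 ∉ A) : Holds G s' :=
  ⟨(hA.reg 0 hX).trans h.size, fun i j => by rw [hA.arr 0 h0]; exact h.adj i j,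
    fun k => by rw [hA.arr 5 h5]; exact h.empty k⟩

def pairTime (n T : ℕ) : ℕ := 2 + (n + 1) * ((n + 1) * (T + 16) + 8)

/-- Without multiplication the matrix index `i * n + j` is not computed but carried along: register
`3` is incremented once per pair. The visited pairs are those of smaller index. -/
theorem does_pairLoop {n : ℕ} {G : SimpleGraph (Fin n)} {body : Program}
    (Inv : Finset (Fin n × Fin n) → State → Prop) (hG : Holds G s)
    (hb : ∀ x < 4, x ∉ body.regs) (h0 : 0 ∉ body.arrs) (h5 : 5 ∉ body.arrs)
    (hInv : ∀ A s s', Agree {1, 2, 3} ∅ s s' → Inv A s → Inv A s') (hs : Inv ∅ s)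
    (hskip : ∀ A i j s, ¬ G.Adj i j → Inv A s → Inv (insert (i, j) A) s)
    (hbody : ∀ A (i j : Fin n), (i, j) ∉ A → G.Adj i j → ∀ s', s'.reg 1 = (i : ℕ) → s'.reg 2 = (j : ℕ) →
      Agree (insert 1 (insert 2 (insert 3 body.regs))) body.arrs s s' → Inv A s' →
      Does body T s' (Inv (insert (i, j) A))) :
    Does (pairLoop body) (pairTime n T) s (Inv univ) := by
  set F : ℕ → Finset (Fin n × Fin n) := fun m =>
    univ.filter fun q : Fin n × Fin n => (q.1 : ℕ) * n + q.2 < m with hF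
  have hF0 : F 0 = ∅ := by simp [hF]
  have hFn : F (n * n) = univ := by
    ext q
    have := q.1.2
    have := q.2.2
    simp only [hF, mem_filter, mem_univ, true_and, iff_true]
    nlinarith
  have hFs : ∀ i j : Fin n, F (i * n + j + 1) = insert (i, j) (F (i * n + j)) := by
    intro i j
    ext q
    simp only [hF, mem_filter, mem_univ, true_and, mem_insert]
    constructor
    · intro h
      rcases Nat.lt_succ_iff_lt_or_eq.1 h with h | h
      · exact Or.inr h
      · exact Or.inl (Prod.ext (mul_add_inj h).1 (mul_add_inj h).2)
    · rintro (rfl | h)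
      · exact Nat.lt_succ_self _
      · exact h.trans (Nat.lt_succ_self _)
  have hb0 := hb 0 (by norm_num)
  have hb1 := hb 1 (by norm_num)
  have hb2 := hb 2 (by norm_num)
  have hb3 := hb 3 (by norm_num)
  have inv_up : ∀ {A s x m}, x ∈ ({1, 2, 3} : Finset ℕ) → Inv A s →
      Inv A ⟨Function.update s.reg x m, s.arr⟩ := fun hx h => hInv _ _ _ (agree_update hx _ _) h
  set inner : Program :=
    .seq (.ite (.get 0 (.reg 3)) body .skip) (.assign 3 (.add (.reg 3) (.const 1))) with hinner
  have hregs : inner.regs = insert 3 body.regs := by ext; simp [hinner, Program.regs]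
  have harrs : inner.arrs = body.arrs := by simp [hinner, Program.arrs]
  refine ((does_assign (s := s) 3 (.const 0)
    (Q := fun s' => s' = ⟨Function.update s.reg 3 0, s.arr⟩) rfl).seq (T' := (n + 1) *
      ((n + 1) * (T + 16) + 8)) fun s₀ hs₀ => ?_).mono (by simp [pairTime, Expr.cost])
        fun _ h => h
  have hA₀ : Agree {1, 2, 3} ∅ s s₀ := hs₀ ▸ agree_update (by simp) _ _
  have key := does_forLoop (s := s₀) (n := n) (c := 1) (body := forLoop 2 inner)
    (T := (n + 1) * (T + 16))
    (fun i s' => Inv (F (i * n)) s' ∧ s'.reg 3 = i * n) (by norm_num) (by simp [hregs, hb1])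
    (by simp [hregs, hb0])
    (fun k s' m h => ⟨inv_up (by simp) h.1, by simpa using h.2⟩)
    (by rw [hA₀.reg 0 (by simp), hG.size])
    ⟨by rw [zero_mul, hF0]; exact hInv _ _ _ hA₀ hs, by simp [hs₀]⟩
    (fun i hi s₁ hi₁ hA₁ hI₁ => by
      have hA₁' : Agree (insert 1 (insert 2 (insert 3 body.regs))) body.arrs s s₁ :=
        (hA₀.mono (by intro x; simp; tauto) (empty_subset _)).trans (by
          simpa only [regs_forLoop, arrs_forLoop, hregs, harrs] using hA₁)
      have h := does_forLoop (s := s₁) (n := n) (c := 2) (body := inner) (T := T + 8)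
        (fun j s' => Inv (F (i * n + j)) s' ∧ s'.reg 3 = i * n + j) (by norm_num)
        (by simp [hregs, hb2]) (by simp [hregs, hb0])
        (fun k s' m h => ⟨inv_up (by simp) h.1, by simpa using h.2⟩)
        (by rw [hA₁'.reg 0 (by simp [hb0]), hG.size]) (by simpa using hI₁)
        (fun j hj s₂ hj₂ hA₂ hI₂ => by
          have hA₂' : Agree (insert 1 (insert 2 (insert 3 body.regs))) body.arrs s s₂ :=
            hA₁'.trans (hA₂.mono (by rw [hregs]; exact subset_insert _ _) (by rw [harrs]))
          have hG₂ : Holds G s₂ := hG.agree hA₂' (by simp [hb0]) h0 h5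
          have hi₂ : s₂.reg 1 = i := by rw [hA₂.reg 1 (by simp [hregs, hb1]), hi₁]
          have e := hFs ⟨i, hi⟩ ⟨j, hj⟩
          simp only at e
          have h₁ : Does (.ite (.get 0 (.reg 3)) body .skip) (3 + (T + 1)) s₂ fun s' =>
              Inv (insert (⟨i, hi⟩, ⟨j, hj⟩) (F (i * n + j))) s' ∧ s'.reg 3 = i * n + j := by
            refine (does_ite (T := T) (T' := 1) (.get 0 (.reg 3)) (fun he => ?_) fun he => ?_)
            · refine (hbody _ ⟨i, hi⟩ ⟨j, hj⟩ (by simp [hF]) ?_ s₂ hi₂ hj₂ hA₂' hI₂.1).frame.mono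
                le_rfl fun s' hs' => ⟨hs'.1, by rw [hs'.2.reg 3 hb3, hI₂.2]⟩
              rw [← hG₂.adj]
              simpa [Expr.eval, hI₂.2] using he
            · refine does_skip ⟨hskip _ _ _ _ ?_ hI₂.1, hI₂.2⟩
              rw [← hG₂.adj, not_not]
              simpa [Expr.eval, hI₂.2] using he
          refine (h₁.seq fun s' hs' => does_assign 3 _ ?_).mono (T' := T + 8)
            (by simp [Expr.cost]; omega) fun _ h => h
          refine ⟨?_, by simp [Expr.eval, hs'.2]; omega⟩
          rw [← add_assoc, e]
          exact inv_up (by simp) hs'.1)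
      refine h.mono (by ring_nf; rfl) fun s' hs' => ?_
      rw [Nat.succ_mul]
      exact hs')
  rw [hFn] at key
  exact key.mono (by ring_nf; rfl) fun _ h => h.1

end Rules

end RAM

namespace RAM

open Finset HyperbolicCut

/-! ### The search program -/

/-- The set of nodes with a nonzero entry in the array `a`. -/
def supp (n a : ℕ) (s : State) : Finset (Fin n) :=
  univ.filter fun i => s.arr a (i : ℕ) ≠ 0

theorem mem_supp {n a : ℕ} {s : State} {v : Fin n} : v ∈ supp n a s ↔ s.arr a (v : ℕ) ≠ 0 := by
  simp [supp]

theorem supp_congr {n a b : ℕ} {s s' : State} (h : s'.arr a = s.arr b) :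
    supp n a s' = supp n b s := by
  simp [supp, h]

section Search

variable {n : ℕ} {G : SimpleGraph (Fin n)} {s : State}

def copyArr (a b : ℕ) : Program := forLoop 4 (.store b (.reg 4) (.get a (.reg 4)))

@[simp] theorem regs_copyArr (a b : ℕ) : (copyArr a b).regs = {4} := by
  simp [copyArr, Program.regs]

@[simp] theorem arrs_copyArr (a b : ℕ) : (copyArr a b).arrs = {b} := by
  simp [copyArr, Program.arrs]

theorem does_copyArr {a b : ℕ} (hab : a ≠ b) (hn : s.reg 0 = n) :
    Does (copyArr a b) ((n + 1) * 12) s fun s' => supp n b s' = supp n a s := by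
  refine (does_vertexLoop (T := 4) (fun A s' => ∀ v ∈ A, s'.arr b (v : ℕ) = s.arr a (v : ℕ))
    (by norm_num) (by simp [Program.regs]) (by simp [Program.regs]) (fun _ _ _ h => h) hn
    (by simp) fun A v hv s₁ hs₁ hA hI => ?_).mono le_rfl fun s' hs' => ?_
  · refine (does_store _ _ _ ?_).mono (by simp [Expr.cost]) fun _ h => h
    have ha := hA.arr a (by simpa [Program.arrs] using hab)
    intro w hw
    rw [mem_insert] at hw
    by_cases hwv : w = v
    · simp [Expr.eval, hs₁, hwv, ha]
    · have : (w : ℕ) ≠ v := fun h => hwv (Fin.ext h)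
      simpa [Expr.eval, hs₁, this] using hI w (hw.resolve_left hwv)
  · ext v
    rw [mem_supp, mem_supp, hs' v (mem_univ v)]

def clearArr (b : ℕ) : Program := forLoop 4 (.store b (.reg 4) (.const 0))

@[simp] theorem regs_clearArr (b : ℕ) : (clearArr b).regs = {4} := by
  simp [clearArr, Program.regs]

@[simp] theorem arrs_clearArr (b : ℕ) : (clearArr b).arrs = {b} := by
  simp [clearArr, Program.arrs]

theorem does_clearArr (b : ℕ) (hn : s.reg 0 = n) :
    Does (clearArr b) ((n + 1) * 11) s fun s' => supp n b s' = ∅ := by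
  refine (does_vertexLoop (T := 3) (fun A s' => ∀ v ∈ A, s'.arr b (v : ℕ) = 0)
    (by norm_num) (by simp [Program.regs]) (by simp [Program.regs]) (fun _ _ _ h => h) hn
    (by simp) fun A v hv s₁ hs₁ hA hI => ?_).mono le_rfl fun s' hs' => ?_
  · refine (does_store _ _ _ ?_).mono (by simp [Expr.cost]) fun _ h => h
    intro w hw
    rw [mem_insert] at hw
    by_cases hwv : w = v
    · simp [Expr.eval, hs₁, hwv]
    · have : (w : ℕ) ≠ v := fun h => hwv (Fin.ext h)
      simpa [Expr.eval, hs₁, this] using hI w (hw.resolve_left hwv)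
  · ext v
    simp [mem_supp, hs' v (mem_univ v)]

/-- Inserting the node in the register `x` into the set in the array `b`. -/
def insertNode (b x : ℕ) : Program := .store b (.reg x) (.const 1)

@[simp] theorem regs_insertNode (b x : ℕ) : (insertNode b x).regs = ∅ := rfl

@[simp] theorem arrs_insertNode (b x : ℕ) : (insertNode b x).arrs = {b} := rfl

theorem does_insertNode (b : ℕ) {x : ℕ} {v : Fin n} (hx : s.reg x = v) :
    Does (insertNode b x) 3 s fun s' => supp n b s' = insert v (supp n b s) := by
  refine does_store _ _ _ ?_
  ext w
  rw [mem_insert, mem_supp, mem_supp]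
  by_cases hwv : w = v
  · simp [Expr.eval, hx, hwv]
  · have : (w : ℕ) ≠ v := fun h => hwv (Fin.ext h)
    simp [Expr.eval, hx, this, hwv]

/-- Expanding the set in the array `a` once without entering the set in the array `b`. -/
def expandArr (a b : ℕ) : Program :=
  .seq (copyArr a 4) (.seq
    (pairLoop (.ite (.get a (.reg 1)) (.ite (.get b (.reg 2)) .skip (.store 4 (.reg 2) (.const 1)))
      .skip))
    (copyArr 4 a))

@[simp] theorem regs_expandArr (a b : ℕ) : (expandArr a b).regs = {1, 2, 3, 4} := by
  ext; simp [expandArr, Program.regs]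

@[simp] theorem arrs_expandArr (a b : ℕ) : (expandArr a b).arrs = {4, a} := by
  ext; simp [expandArr, Program.arrs]

def expandTime (n : ℕ) : ℕ := (n + 1) * 12 + (pairTime n 11 + (n + 1) * 12)

/-- The new set is built in the scratch array `4` while membership is tested in the unchanged array
`a`; otherwise nodes added in this round could be expanded at once. -/
theorem does_expandArr {a b : ℕ} (ha : a ≠ 4) (hb : b ≠ 4) (hG : Holds G s) :
    Does (expandArr a b) (expandTime n) s fun s' =>
      supp n a s' = expand G (supp n b s) (supp n a s) := by
  refine (does_copyArr ha hG.size).frame.seq fun s₁ ⟨h₁, hA₁⟩ => ?_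
  have hG₁ := hG.agree hA₁ (by simp) (by simp) (by simp)
  have ea : s₁.arr a = s.arr a := hA₁.arr a (by simpa using ha)
  have eb : s₁.arr b = s.arr b := hA₁.arr b (by simpa using hb)
  have h₂ := does_pairLoop (s := s₁) (G := G) (T := 11)
    (body := .ite (.get a (.reg 1)) (.ite (.get b (.reg 2)) .skip (.store 4 (.reg 2) (.const 1)))
      .skip)
    (fun A s' => ∀ v, v ∈ supp n 4 s' ↔ v ∈ supp n a s ∨
      (v ∉ supp n b s ∧ ∃ u ∈ supp n a s, G.Adj u v ∧ (u, v) ∈ A))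
    hG₁ (by simp [Program.regs]) (by simp [Program.arrs]) (by simp [Program.arrs])
    (fun A s₂ s₃ hA h => by rwa [supp_congr (hA.arr 4 (by simp))])
    (by simp [h₁])
    (fun A i j s₂ hij h v => by
      rw [h v]
      refine or_congr Iff.rfl (and_congr Iff.rfl (exists_congr fun u => and_congr Iff.rfl
        (and_congr_right fun huv => ?_)))
      rw [mem_insert, Prod.mk.injEq, or_iff_right]
      rintro ⟨rfl, rfl⟩
      exact hij huv)
    (fun A i j hA hij s₂ hi hj hA₂ h => by
      have ea₂ : s₂.arr a = s.arr a := by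
        rw [hA₂.arr a (by simpa [Program.arrs] using ha), ea]
      have eb₂ : s₂.arr b = s.arr b := by
        rw [hA₂.arr b (by simpa [Program.arrs] using hb), eb]
      have irrelevant : (i ∉ supp n a s ∨ j ∈ supp n b s) →
          ∀ v, v ∈ supp n 4 s₂ ↔ v ∈ supp n a s ∨ (v ∉ supp n b s ∧ ∃ u ∈ supp n a s, G.Adj u v ∧
            (u, v) ∈ insert (i, j) A) := by
        intro hij' v
        rw [h v]
        refine or_congr Iff.rfl (and_congr_right fun hv => exists_congr fun u =>
          and_congr_right fun hu => and_congr_right fun _ => ?_)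
        rw [mem_insert, Prod.mk.injEq, or_iff_right]
        rintro ⟨rfl, rfl⟩
        exact hij'.elim (fun h => h hu) hv
      refine (does_ite (T := 7) (T' := 1) _ (fun he => ?_) fun he => ?_).mono
        (by simp [Expr.cost]) fun _ h => h
      · refine (does_ite (T := 1) (T' := 3) _ (fun he' => ?_) fun he' => ?_).mono
          (by simp [Expr.cost]) fun _ h => h
        · refine does_skip (irrelevant (Or.inr (mem_supp.2 ?_)))
          simpa [Expr.eval, hj, eb₂] using he'
        · refine does_store _ _ _ fun v => ?_
          have hi' : i ∈ supp n a s := mem_supp.2 (by simpa [Expr.eval, hi, ea₂] using he)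
          have hj' : j ∉ supp n b s := fun hjb =>
            mem_supp.1 hjb (by simpa [Expr.eval, hj, eb₂] using he')
          by_cases hv : v = j
          · subst hv
            simp only [mem_supp (a := 4), Expr.eval, hj, Function.update_self]
            simp only [ne_eq, one_ne_zero, not_false_eq_true, true_iff]
            exact Or.inr ⟨hj', i, hi', hij, mem_insert_self _ _⟩
          · have hv' : (v : ℕ) ≠ j := fun h => hv (Fin.ext h)
            have := h v
            simp only [mem_supp (a := 4)] at this
            simp only [mem_supp (a := 4), Expr.eval, hj, Function.update_self,
              Function.update_of_ne hv']
            rw [this]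
            refine or_congr Iff.rfl (and_congr_right fun _ => exists_congr fun u =>
              and_congr_right fun hu => and_congr_right fun _ => ?_)
            rw [mem_insert, Prod.mk.injEq, or_iff_right]
            exact fun h' => hv h'.2
      · refine does_skip (irrelevant (Or.inl fun hia => mem_supp.1 hia ?_))
        simpa [Expr.eval, hi, ea₂] using he)
  refine h₂.frame.seq fun s₂ ⟨h₂, hA₂⟩ => ?_
  have hG₂ := hG₁.agree hA₂ (by simp [Program.regs]) (by simp [Program.arrs])
    (by simp [Program.arrs])
  refine (does_copyArr (Ne.symm ha) hG₂.size).mono le_rfl fun s₃ h₃ => ?_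
  rw [h₃]
  ext v
  rw [h₂ v, mem_expand]
  simp

/-- The condition that the program tests for candidates. -/
def Passes (K M : ℕ) (G : SimpleGraph (Fin n)) [DecidableRel G.Adj] (S : Finset (Fin n)) : Prop :=
  S.Nonempty ∧ K * S.card ≤ n ∧ M * cutSize G S ≤ vol G S

/-- Computing the volume and `M` times the cut size of the set in array `3`. -/
def measure (M : ℕ) : Program :=
  pairLoop (.ite (.get 3 (.reg 1)) (.seq (.assign 5 (.add (.reg 5) (.const 1)))
    (.ite (.get 3 (.reg 2)) .skip (.assign 6 (.add (.reg 6) (.const M))))) .skip)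

@[simp] theorem regs_measure (M : ℕ) : (measure M).regs = {1, 2, 3, 5, 6} := by
  ext; simp [measure, Program.regs]

@[simp] theorem arrs_measure (M : ℕ) : (measure M).arrs = ∅ := by
  simp [measure, Program.arrs]

theorem vol_eq_card (G : SimpleGraph (Fin n)) [DecidableRel G.Adj] (S : Finset (Fin n)) :
    vol G S = (univ.filter fun q : Fin n × Fin n => G.Adj q.1 q.2 ∧ q.1 ∈ S).card := by
  rw [vol, card_filter, Fintype.sum_prod_type, ← sum_subset (subset_univ S)]
  · refine sum_congr rfl fun v hv => ?_
    simp [hv, ← SimpleGraph.card_neighborFinset_eq_degree, SimpleGraph.neighborFinset_eq_filter]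
  · intro v _ hv
    simp [hv]

/-- The volume counts ordered adjacent pairs that start in the set, the cut those that also end
outside. Adding the constant `M` for each of the latter avoids a multiplication. -/
theorem does_measure [DecidableRel G.Adj] (M : ℕ) (hG : Holds G s) (h5 : s.reg 5 = 0)
    (h6 : s.reg 6 = 0) :
    Does (measure M) (pairTime n 16) s fun s' =>
      s'.reg 5 = vol G (supp n 3 s) ∧ s'.reg 6 = M * cutSize G (supp n 3 s) := by
  set S := supp n 3 s with hS
  refine (does_pairLoop (G := G) (T := 16) (fun A s' =>
    s'.reg 5 = (A.filter fun q => G.Adj q.1 q.2 ∧ q.1 ∈ S).card ∧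
    s'.reg 6 = M * (A.filter fun q => G.Adj q.1 q.2 ∧ q.1 ∈ S ∧ q.2 ∉ S).card) hG
    (by intro x hx; simp [Program.regs]; omega) (by simp [Program.arrs]) (by simp [Program.arrs])
    (fun A s₂ s₃ hA h => by rwa [hA.reg 5 (by simp), hA.reg 6 (by simp)])
    (by simp [h5, h6])
    (fun A i j s₂ hij h => by
      rwa [filter_insert, filter_insert, if_neg (by simp [hij]), if_neg (by simp [hij])])
    (fun A i j hA hij s₂ hi hj hA₂ h => by
      have e3 : s₂.arr 3 = s.arr 3 := hA₂.arr 3 (by simp [Program.arrs])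
      have hiS : s₂.arr 3 i ≠ 0 ↔ i ∈ S := by rw [e3, hS, mem_supp]
      have hjS : s₂.arr 3 j ≠ 0 ↔ j ∈ S := by rw [e3, hS, mem_supp]
      have hA5 : (i, j) ∉ A.filter fun q => G.Adj q.1 q.2 ∧ q.1 ∈ S :=
        fun h => hA (mem_filter.1 h).1
      have hA6 : (i, j) ∉ A.filter fun q => G.Adj q.1 q.2 ∧ q.1 ∈ S ∧ q.2 ∉ S :=
        fun h => hA (mem_filter.1 h).1
      simp only [filter_insert, hij, true_and]
      refine (does_ite (T := 12) (T' := 1) _ (fun he => ?_) fun he => ?_).mono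
        (by simp [Expr.cost]) fun _ h => h
      · have hi' : i ∈ S := hiS.1 (by simpa [Expr.eval, hi] using he)
        refine ((does_assign (Q := fun s' => s' = ⟨Function.update s₂.reg 5 (s₂.reg 5 + 1), s₂.arr⟩)
          5 _ rfl).seq (T' := 8) fun s₃ hs₃ => (does_ite (T := 1) (T' := 4) _ (fun he' => ?_)
            fun he' => ?_).mono (by simp [Expr.cost]) fun _ h => h).mono (by simp [Expr.cost])
              fun _ h => h
        · have hj' : j ∈ S := hjS.1 (by simpa [Expr.eval, hs₃, hj] using he')
          refine does_skip ⟨?_, ?_⟩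
          · simp [hi', hs₃, h.1, card_insert_of_notMem hA5]
          · simp [hj', hs₃, h.2]
        · have hj' : j ∉ S := fun hjm => hjS.2 hjm (by simpa [Expr.eval, hs₃, hj] using he')
          refine does_assign _ _ ⟨?_, ?_⟩
          · simp [hi', hs₃, h.1, card_insert_of_notMem hA5]
          · simp [hi', hj', hs₃, h.2, card_insert_of_notMem hA6, Expr.eval, mul_add]
      · have hi' : i ∉ S := fun him => hiS.2 him (by simpa [Expr.eval, hi] using he)
        exact does_skip ⟨by simp [hi', h.1], by simp [hi', h.2]⟩)).mono le_rfl fun s' hs' => ?_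
  refine ⟨by rw [hs'.1, vol_eq_card], ?_⟩
  rw [hs'.2, cutSize]
  congr 2
  ext ⟨i, j⟩
  simp [SimpleGraph.mk_mem_interedges_iff]
  tauto

/-- Computing `K` times the size of the set in array `3`. -/
def countSize (K : ℕ) : Program :=
  forLoop 4 (.ite (.get 3 (.reg 4)) (.assign 7 (.add (.reg 7) (.const K))) .skip)

@[simp] theorem regs_countSize (K : ℕ) : (countSize K).regs = {4, 7} := by
  ext; simp [countSize, Program.regs]

@[simp] theorem arrs_countSize (K : ℕ) : (countSize K).arrs = ∅ := by
  simp [countSize, Program.arrs]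

theorem does_countSize (K : ℕ) (hn : s.reg 0 = n) (h7 : s.reg 7 = 0) :
    Does (countSize K) ((n + 1) * 16) s fun s' => s'.reg 7 = K * (supp n 3 s).card := by
  refine (does_vertexLoop (T := 8) (fun A s' => s'.reg 7 = K * (A.filter (· ∈ supp n 3 s)).card)
    (by norm_num) (by simp [Program.regs]) (by simp [Program.regs])
    (fun _ _ _ h => by simpa using h) hn
    (by simp [h7]) fun A v hv s₁ hs₁ hA hI => ?_).mono le_rfl fun s' hs' => by simpa using hs'
  have e3 : s₁.arr 3 = s.arr 3 := hA.arr 3 (by simp [Program.arrs])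
  have hv' : v ∉ A.filter (· ∈ supp n 3 s) := fun h => hv (mem_filter.1 h).1
  have hvS : s₁.arr 3 v ≠ 0 ↔ v ∈ supp n 3 s := by rw [e3, mem_supp]
  rw [filter_insert]
  refine (does_ite (T := 4) (T' := 1) _ (fun he => ?_) fun he => ?_).mono
    (by simp [Expr.cost]) fun _ h => h
  · rw [if_pos (hvS.1 (by simpa [Expr.eval, hs₁] using he)), card_insert_of_notMem hv']
    exact does_assign _ _ (by simp [Expr.eval, hI, mul_add])
  · rw [if_neg fun h => hvS.2 h (by simpa [Expr.eval, hs₁] using he)]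
    exact does_skip hI

/-- Saving the set in array `3` to array `1` if it passes. -/
def testSet (K M : ℕ) : Program :=
  .seq (.assign 5 (.const 0)) (.seq (.assign 6 (.const 0)) (.seq (.assign 7 (.const 0))
    (.seq (measure M) (.seq (countSize K)
      (.ite (.reg 7) (.ite (.sub (.reg 7) (.reg 0)) .skip
        (.ite (.sub (.reg 6) (.reg 5)) .skip (copyArr 3 1))) .skip)))))

@[simp] theorem regs_testSet (K M : ℕ) : (testSet K M).regs = {1, 2, 3, 4, 5, 6, 7} := by
  ext; simp [testSet, Program.regs]; tauto

@[simp] theorem arrs_testSet (K M : ℕ) : (testSet K M).arrs = {1} := by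
  ext; simp [testSet, Program.arrs]

def testTime (n : ℕ) : ℕ := 6 + (pairTime n 16 + ((n + 1) * 16 + (13 + (n + 1) * 12)))

/-- The form of the conclusion makes array `1` a monotone record: once it holds a passing set it
always does, and any passing candidate makes it so. -/
theorem does_testSet [DecidableRel G.Adj] {K M : ℕ} (hK : 0 < K) (hG : Holds G s) :
    Does (testSet K M) (testTime n) s fun s' =>
      (Passes K M G (supp n 1 s) ∨ Passes K M G (supp n 3 s)) → Passes K M G (supp n 1 s') := by
  refine ((does_assign 5 (.const 0)
      (Q := fun s' => s' = ⟨Function.update s.reg 5 0, s.arr⟩) rfl).seq (Q := fun s' =>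
      (Passes K M G (supp n 1 s) ∨ Passes K M G (supp n 3 s)) → Passes K M G (supp n 1 s'))
    (T' := 4 + (pairTime n 16 + ((n + 1) * 16 + (13 + (n + 1) * 12))))
    fun s₁ h₁ => ((does_assign 6 (.const 0)
      (Q := fun s' => s' = ⟨Function.update s₁.reg 6 0, s₁.arr⟩) rfl).seq
      (T' := 2 + (pairTime n 16 + ((n + 1) * 16 + (13 + (n + 1) * 12))))
      fun s₂ h₂ => ((does_assign 7 (.const 0)
      (Q := fun s' => s' = ⟨Function.update s₂.reg 7 0, s₂.arr⟩) rfl).seq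
      (T' := (pairTime n 16 + ((n + 1) * 16 + (13 + (n + 1) * 12))))
        fun s₃ h₃ => ?_).mono ?_ fun _ h => h).mono ?_ fun _ h => h).mono ?_ fun _ h => h
  rotate_left
  · simp [Expr.cost]
  · simp only [Expr.cost]; omega
  · simp only [Expr.cost, testTime]; omega
  have hA : Agree {5, 6, 7} ∅ s s₃ :=
    ⟨fun x hx => by
      simp only [mem_insert, mem_singleton, not_or] at hx
      simp [h₁, h₂, h₃, hx], fun _ _ => by simp [h₁, h₂, h₃]⟩
  have hG₃ := hG.agree hA (by simp) (by simp) (by simp)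
  refine (does_measure M hG₃ (by simp [h₁, h₂, h₃]) (by simp [h₂, h₃])).frame.seq
    fun s₄ ⟨h₄, hA₄⟩ => ?_
  have hG₄ := hG₃.agree hA₄ (by simp) (by simp) (by simp)
  refine (does_countSize K hG₄.size (by rw [hA₄.reg 7 (by simp)]; simp [h₃])).frame.seq
    fun s₅ ⟨h₅, hA₅⟩ => ?_
  have hG₅ := hG₄.agree hA₅ (by simp) (by simp) (by simp)
  have arr₄ : ∀ a, s₄.arr a = s.arr a := fun a => by
    rw [hA₄.arr a (by simp), hA.arr a (by simp)]
  have arr₅ : ∀ a, s₅.arr a = s.arr a := fun a => by rw [hA₅.arr a (by simp), arr₄ a]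
  rw [supp_congr (arr₄ 3)] at h₅
  rw [← hA₅.reg 5 (by simp), ← hA₅.reg 6 (by simp), supp_congr (hA.arr 3 (by simp))] at h₄
  have fail : ¬ Passes K M G (supp n 3 s) →
      (Passes K M G (supp n 1 s) ∨ Passes K M G (supp n 3 s)) → Passes K M G (supp n 1 s₅) := by
    intro hn h
    rw [supp_congr (arr₅ 1)]
    exact h.resolve_right hn
  -- The nested tests are the three parts of `Passes`: `K * |S| ≠ 0` means non-empty since `K > 0`,
  -- and a truncated difference vanishes exactly when the inequality holds.
  refine (does_ite (T := 10 + (n + 1) * 12) (T' := 1) _ (fun he => ?_) fun he => ?_).mono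
    (by simp only [Expr.cost]; omega) fun _ h => h
  · refine (does_ite (T := 1) (T' := 5 + (n + 1) * 12) _ (fun he' => ?_) fun he' => ?_).mono
      (by simp only [Expr.cost]; omega) fun _ h => h
    · refine does_skip (fail fun hp => he' ?_)
      simpa [Expr.eval, h₅, hG₅.size] using Nat.sub_eq_zero_of_le hp.2.1
    · refine (does_ite (T := 1) (T' := (n + 1) * 12) _ (fun he'' => ?_) fun he'' => ?_).mono
        (by simp only [Expr.cost]; omega) fun _ h => h
      · refine does_skip (fail fun hp => he'' ?_)
        simpa [Expr.eval, h₄.1, h₄.2] using Nat.sub_eq_zero_of_le hp.2.2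
      · refine (does_copyArr (by norm_num) hG₅.size).mono le_rfl fun s₆ h₆ _ => ?_
        rw [h₆, supp_congr (arr₅ 3)]
        simp only [Expr.eval, h₄.1, h₄.2, h₅, hG₅.size] at he he' he''
        refine ⟨card_pos.1 (Nat.pos_of_ne_zero fun h => he (by simp [h])),
          Nat.le_of_sub_eq_zero he', Nat.le_of_sub_eq_zero he''⟩
  · refine does_skip (fail fun hp => ?_)
    simp only [Expr.eval, h₅] at he
    have := card_pos.2 hp.1
    exact absurd he (by positivity)

end Search

end RAM

/-! ### Enumeration of all confined searches -/

namespace RAM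

open Finset HyperbolicCut

section Search

variable {n : ℕ} {G : SimpleGraph (Fin n)} [DecidableRel G.Adj] {s : State} {K M : ℕ}

/-- Testing all stages of the search from the set in array `3` that avoids the set in array `2`. -/
def testStages (K M : ℕ) : Program := forLoop 8 (.seq (testSet K M) (expandArr 3 2))

@[simp] theorem regs_testStages (K M : ℕ) :
    (testStages K M).regs = {1, 2, 3, 4, 5, 6, 7, 8} := by
  ext; simp [testStages, Program.regs]; tauto

@[simp] theorem arrs_testStages (K M : ℕ) : (testStages K M).arrs = {1, 3, 4} := by
  ext; simp [testStages, Program.arrs]; tauto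

def stagesTime (n : ℕ) : ℕ := (n + 1) * (testTime n + expandTime n + 8)

/-- Each stage is tested before it is expanded, so the stages `0, …, n - 1` are covered. -/
theorem does_testStages (hK : 0 < K) (hG : Holds G s) :
    Does (testStages K M) (stagesTime n) s fun s' =>
      (Passes K M G (supp n 1 s) ∨
        ∃ k < n, Passes K M G ((expand G (supp n 2 s))^[k] (supp n 3 s))) →
      Passes K M G (supp n 1 s') := by
  refine (does_forLoop (T := testTime n + expandTime n) (fun k s' =>
    supp n 3 s' = (expand G (supp n 2 s))^[k] (supp n 3 s) ∧
    ((Passes K M G (supp n 1 s) ∨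
        ∃ k' < k, Passes K M G ((expand G (supp n 2 s))^[k'] (supp n 3 s))) →
      Passes K M G (supp n 1 s'))) (by norm_num) (by simp [Program.regs]) (by simp [Program.regs])
    (fun _ _ _ h => h) hG.size (by simp) fun k hk s₁ hs₁ hA hI => ?_).mono le_rfl
      fun s' hs' => hs'.2
  have hG₁ := hG.agree hA (by simp [Program.regs]) (by simp [Program.arrs])
    (by simp [Program.arrs])
  refine (does_testSet hK hG₁).frame.seq fun s₂ ⟨h₂, hA₂⟩ => ?_
  have hG₂ := hG₁.agree hA₂ (by simp) (by simp) (by simp)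
  refine (does_expandArr (by norm_num) (by norm_num) hG₂).frame.mono le_rfl
    fun s₃ ⟨h₃, hA₃⟩ => ⟨?_, ?_⟩
  · rw [h₃, Function.iterate_succ_apply', ← hI.1, supp_congr (hA₂.arr 2 (by simp)),
      supp_congr (hA₂.arr 3 (by simp)), supp_congr (hA.arr 2 (by simp [Program.arrs]))]
  · rw [supp_congr (hA₃.arr 1 (by simp))]
    rintro (h | ⟨k', hk', h⟩)
    · exact h₂ (Or.inl (hI.2 (Or.inl h)))
    · rcases Nat.lt_succ_iff_lt_or_eq.1 hk' with hk' | rfl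
      · exact h₂ (Or.inl (hI.2 (Or.inr ⟨k', hk', h⟩)))
      · exact h₂ (Or.inr (hI.1 ▸ h))

/-- Testing the searches from all nodes that avoid the set in array `2`. -/
def testCenters (K M : ℕ) : Program :=
  forLoop 9 (.seq (clearArr 3) (.seq (insertNode 3 9) (testStages K M)))

@[simp] theorem regs_testCenters (K M : ℕ) :
    (testCenters K M).regs = {1, 2, 3, 4, 5, 6, 7, 8, 9} := by
  ext; simp [testCenters, Program.regs]; tauto

@[simp] theorem arrs_testCenters (K M : ℕ) : (testCenters K M).arrs = {1, 3, 4} := by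
  ext; simp [testCenters, Program.arrs]

def centersTime (n : ℕ) : ℕ := (n + 1) * ((n + 1) * 11 + (3 + stagesTime n) + 8)

theorem does_testCenters (hK : 0 < K) (hG : Holds G s) :
    Does (testCenters K M) (centersTime n) s fun s' =>
      (Passes K M G (supp n 1 s) ∨
        ∃ p, ∃ k < n, Passes K M G ((expand G (supp n 2 s))^[k] {p})) →
      Passes K M G (supp n 1 s') := by
  refine (does_vertexLoop (T := (n + 1) * 11 + (3 + stagesTime n)) (fun A s' =>
    (Passes K M G (supp n 1 s) ∨
        ∃ p ∈ A, ∃ k < n, Passes K M G ((expand G (supp n 2 s))^[k] {p})) →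
      Passes K M G (supp n 1 s')) (by norm_num) (by simp [Program.regs]) (by simp [Program.regs])
    (fun _ _ _ h => h) hG.size (by simp) fun A v hv s₁ hs₁ hA hI => ?_).mono le_rfl
      fun s' hs' => by simpa using hs'
  have hG₁ := hG.agree hA (by simp [Program.regs]) (by simp [Program.arrs])
    (by simp [Program.arrs])
  refine (does_clearArr 3 hG₁.size).frame.seq fun s₂ ⟨h₂, hA₂⟩ => ?_
  have hG₂ := hG₁.agree hA₂ (by simp) (by simp) (by simp)
  refine (does_insertNode 3 (x := 9) (v := v) (by rw [hA₂.reg 9 (by simp), hs₁])).frame.seq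
    fun s₃ ⟨h₃, hA₃⟩ => ?_
  have hG₃ := hG₂.agree hA₃ (by simp) (by simp) (by simp)
  refine (does_testStages hK hG₃).mono le_rfl fun s₄ h₄ h => h₄ ?_
  rw [h₃, h₂, supp_congr (hA₃.arr 1 (by simp)), supp_congr (hA₂.arr 1 (by simp)),
    supp_congr (hA₃.arr 2 (by simp)), supp_congr (hA₂.arr 2 (by simp)),
    supp_congr (hA.arr 2 (by simp [Program.arrs])), insert_empty_eq]
  rcases h with h | ⟨p, hp, h⟩
  · exact Or.inl (hI (Or.inl h))
  · rcases mem_insert.1 hp with rfl | hp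
    · exact Or.inr h
    · exact Or.inl (hI (Or.inr ⟨p, hp, h⟩))

/-- Testing all searches that avoid a ball around the set in array `2`. -/
def testRadii (K M : ℕ) : Program := forLoop 10 (.seq (testCenters K M) (expandArr 2 5))

@[simp] theorem regs_testRadii (K M : ℕ) :
    (testRadii K M).regs = {1, 2, 3, 4, 5, 6, 7, 8, 9, 10} := by
  ext; simp [testRadii, Program.regs]; tauto

@[simp] theorem arrs_testRadii (K M : ℕ) : (testRadii K M).arrs = {1, 2, 3, 4} := by
  ext; simp [testRadii, Program.arrs]; tauto

def radiiTime (n : ℕ) : ℕ := (n + 1) * (centersTime n + expandTime n + 8)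

theorem does_testRadii (hK : 0 < K) (hG : Holds G s) :
    Does (testRadii K M) (radiiTime n) s fun s' =>
      (Passes K M G (supp n 1 s) ∨ ∃ r < n, ∃ p, ∃ k < n,
        Passes K M G ((expand G ((expand G ∅)^[r] (supp n 2 s)))^[k] {p})) →
      Passes K M G (supp n 1 s') := by
  refine (does_forLoop (T := centersTime n + expandTime n) (fun r s' =>
    supp n 2 s' = (expand G ∅)^[r] (supp n 2 s) ∧
    ((Passes K M G (supp n 1 s) ∨ ∃ r' < r, ∃ p, ∃ k < n,
        Passes K M G ((expand G ((expand G ∅)^[r'] (supp n 2 s)))^[k] {p})) →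
      Passes K M G (supp n 1 s'))) (by norm_num) (by simp [Program.regs]) (by simp [Program.regs])
    (fun _ _ _ h => h) hG.size (by simp) fun r hr s₁ hs₁ hA hI => ?_).mono le_rfl
      fun s' hs' => hs'.2
  have hG₁ := hG.agree hA (by simp [Program.regs]) (by simp [Program.arrs])
    (by simp [Program.arrs])
  refine (does_testCenters hK hG₁).frame.seq fun s₂ ⟨h₂, hA₂⟩ => ?_
  have hG₂ := hG₁.agree hA₂ (by simp) (by simp) (by simp)
  -- The permanently empty array `5` serves as forbidden set, so the ball itself grows without
  -- restriction.
  have e₅ : supp n 5 s₂ = ∅ := by ext v; simp [mem_supp, hG₂.empty]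
  refine (does_expandArr (by norm_num) (by norm_num) hG₂).frame.mono le_rfl
    fun s₃ ⟨h₃, hA₃⟩ => ⟨?_, ?_⟩
  · rw [h₃, Function.iterate_succ_apply', ← hI.1, e₅, supp_congr (hA₂.arr 2 (by simp))]
  · rw [supp_congr (hA₃.arr 1 (by simp))]
    rintro (h | ⟨r', hr', h⟩)
    · exact h₂ (Or.inl (hI.2 (Or.inl h)))
    · rcases Nat.lt_succ_iff_lt_or_eq.1 hr' with hr' | rfl
      · exact h₂ (Or.inl (hI.2 (Or.inr ⟨r', hr', h⟩)))
      · exact h₂ (Or.inr (hI.1 ▸ h))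

/-- Testing all searches that avoid two balls around the node in register `11` and another node. -/
def testSecondBall (K M : ℕ) : Program :=
  forLoop 12 (.seq (clearArr 2) (.seq (insertNode 2 11) (.seq (insertNode 2 12) (testRadii K M))))

@[simp] theorem regs_testSecondBall (K M : ℕ) :
    (testSecondBall K M).regs = {1, 2, 3, 4, 5, 6, 7, 8, 9, 10, 12} := by
  ext; simp [testSecondBall, Program.regs]; tauto

@[simp] theorem arrs_testSecondBall (K M : ℕ) : (testSecondBall K M).arrs = {1, 2, 3, 4} := by
  ext; simp [testSecondBall, Program.arrs]; tauto

def secondBallTime (n : ℕ) : ℕ := (n + 1) * ((n + 1) * 11 + (3 + (3 + radiiTime n)) + 8)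

theorem does_testSecondBall (hK : 0 < K) (hG : Holds G s) {x : Fin n} (hx : s.reg 11 = x) :
    Does (testSecondBall K M) (secondBallTime n) s fun s' =>
      (Passes K M G (supp n 1 s) ∨ ∃ y, ∃ r < n, ∃ p, ∃ k < n,
        Passes K M G ((expand G ((expand G ∅)^[r] {x, y}))^[k] {p})) →
      Passes K M G (supp n 1 s') := by
  refine (does_vertexLoop (T := (n + 1) * 11 + (3 + (3 + radiiTime n))) (fun A s' =>
    (Passes K M G (supp n 1 s) ∨ ∃ y ∈ A, ∃ r < n, ∃ p, ∃ k < n,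
        Passes K M G ((expand G ((expand G ∅)^[r] {x, y}))^[k] {p})) →
      Passes K M G (supp n 1 s')) (by norm_num) (by simp [Program.regs]) (by simp [Program.regs])
    (fun _ _ _ h => h) hG.size (by simp) fun A y hy s₁ hs₁ hA hI => ?_).mono le_rfl
      fun s' hs' => by simpa using hs'
  have hG₁ := hG.agree hA (by simp [Program.regs]) (by simp [Program.arrs])
    (by simp [Program.arrs])
  refine (does_clearArr 2 hG₁.size).frame.seq fun s₂ ⟨h₂, hA₂⟩ => ?_
  have hG₂ := hG₁.agree hA₂ (by simp) (by simp) (by simp)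
  refine (does_insertNode 2 (x := 11) (v := x) (by
    rw [hA₂.reg 11 (by simp), hA.reg 11 (by simp [Program.regs]), hx])).frame.seq
    fun s₃ ⟨h₃, hA₃⟩ => ?_
  have hG₃ := hG₂.agree hA₃ (by simp) (by simp) (by simp)
  refine (does_insertNode 2 (x := 12) (v := y) (by
    rw [hA₃.reg 12 (by simp), hA₂.reg 12 (by simp), hs₁])).frame.seq
    fun s₄ ⟨h₄, hA₄⟩ => ?_
  have hG₄ := hG₃.agree hA₄ (by simp) (by simp) (by simp)
  refine (does_testRadii hK hG₄).mono le_rfl fun s₅ h₅ h => h₅ ?_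
  rw [h₄, h₃, h₂, supp_congr (hA₄.arr 1 (by simp)), supp_congr (hA₃.arr 1 (by simp)),
    supp_congr (hA₂.arr 1 (by simp)), insert_empty_eq, pair_comm]
  rcases h with h | ⟨y', hy', h⟩
  · exact Or.inl (hI (Or.inl h))
  · rcases mem_insert.1 hy' with rfl | hy'
    · exact Or.inr h
    · exact Or.inl (hI (Or.inr ⟨y', hy', h⟩))

/-- Testing all searches that avoid two balls of equal radius. -/
def search (K M : ℕ) : Program := forLoop 11 (testSecondBall K M)

def searchTime (n : ℕ) : ℕ := (n + 1) * (secondBallTime n + 8)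

theorem does_search (hK : 0 < K) (hG : Holds G s) :
    Does (search K M) (searchTime n) s fun s' =>
      (∃ x y, ∃ r < n, ∃ p, ∃ k < n,
        Passes K M G ((expand G ((expand G ∅)^[r] {x, y}))^[k] {p})) →
      Passes K M G (supp n 1 s') := by
  refine (does_vertexLoop (T := secondBallTime n) (fun A s' =>
    (∃ x ∈ A, ∃ y, ∃ r < n, ∃ p, ∃ k < n,
        Passes K M G ((expand G ((expand G ∅)^[r] {x, y}))^[k] {p})) →
      Passes K M G (supp n 1 s')) (by norm_num) (by simp) (by simp)
    (fun _ _ _ h => h) hG.size (by simp) fun A x hx s₁ hs₁ hA hI => ?_).mono le_rfl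
      fun s' hs' => by simpa using hs'
  have hG₁ := hG.agree hA (by simp) (by simp) (by simp)
  refine (does_testSecondBall hK hG₁ hs₁).mono le_rfl fun s₂ h₂ ⟨x', hx', h⟩ => h₂ ?_
  rcases mem_insert.1 hx' with rfl | hx'
  · exact Or.inr h
  · exact Or.inl (hI ⟨x', hx', h⟩)

-- The nesting depth of the loops is fixed, so the time bounds compose to one polynomial, the same
-- for all `K` and `M`.
open Polynomial in
theorem exists_polynomial_searchTime : ∃ P : Polynomial ℕ, ∀ n, searchTime n = P.eval n := by
  let pair : ℕ → ℕ[X] := fun T => 2 + (X + 1) * ((X + 1) * (C T + 16) + 8)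
  let expand : ℕ[X] := (X + 1) * 12 + (pair 11 + (X + 1) * 12)
  let test : ℕ[X] := 6 + (pair 16 + ((X + 1) * 16 + (13 + (X + 1) * 12)))
  let stages : ℕ[X] := (X + 1) * (test + expand + 8)
  let centers : ℕ[X] := (X + 1) * ((X + 1) * 11 + (3 + stages) + 8)
  let radii : ℕ[X] := (X + 1) * (centers + expand + 8)
  let second : ℕ[X] := (X + 1) * ((X + 1) * 11 + (3 + (3 + radii)) + 8)
  refine ⟨(X + 1) * (second + 8), fun n => ?_⟩
  simp [searchTime, secondBallTime, radiiTime, centersTime, stagesTime, testTime, expandTime,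
    pairTime, second, radii, centers, stages, test, expand, pair]

end Search

theorem holds_input {n : ℕ} (G : SimpleGraph (Fin n)) [DecidableRel G.Adj] :
    Holds G (input G) where
  size := by simp [input]
  adj i j := by
    simp only [input, true_and]
    constructor
    · intro h
      split_ifs at h with h'
      · obtain ⟨i', j', hadj, e⟩ := h'
        obtain ⟨rfl, rfl⟩ := mul_add_inj e
        exact hadj
      · exact absurd rfl h
    · intro h
      rw [if_pos ⟨i, j, h, rfl⟩]
      exact one_ne_zero
  empty k := by simp [input]

/-! ### Decision tables -/

/-- Different states differ in some cell `e`; the two truncated differences of `e` and its value in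
`s` add up to the absolute difference. -/
theorem exists_separating_expr {s s' : State} (h : s ≠ s') :
    ∃ e : Expr, e.eval s = 0 ∧ e.eval s' ≠ 0 := by
  have of_expr : ∀ e : Expr, e.eval s ≠ e.eval s' → ∃ e : Expr, e.eval s = 0 ∧ e.eval s' ≠ 0 := by
    intro e he
    refine ⟨.add (.sub e (.const (e.eval s))) (.sub (.const (e.eval s)) e), ?_, ?_⟩
    · simp [Expr.eval]
    · simp only [Expr.eval]; omega
  by_contra hcon
  refine h ?_
  obtain ⟨r, a⟩ := s
  obtain ⟨r', a'⟩ := s'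
  congr
  · funext x
    by_contra hx
    exact hcon (of_expr (.reg x) hx)
  · funext b k
    by_contra hb
    exact hcon (of_expr (.get b (.const k)) hb)

/-- A sum of natural numbers vanishes only if all summands do, so adding separating expressions
tests against all of `L`. -/
theorem exists_expr_isolating (s : State) (L : List State) (h : s ∉ L) :
    ∃ e : Expr, e.eval s = 0 ∧ ∀ s' ∈ L, e.eval s' ≠ 0 := by
  induction L with
  | nil => exact ⟨.const 0, rfl, by simp⟩
  | cons s₁ L ih =>
    rw [List.mem_cons, not_or] at h
    obtain ⟨e, he, heL⟩ := ih h.2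
    obtain ⟨f, hf, hf₁⟩ := exists_separating_expr h.1
    refine ⟨.add e f, by simp [Expr.eval, he, hf], fun s' hs' => ?_⟩
    rcases List.mem_cons.1 hs' with rfl | hs'
    · simp only [Expr.eval]; omega
    · have := heL s' hs'
      simp only [Expr.eval]; omega

/-- Finitely many requirements on the results of a program for single initial states can be met by
one program. -/
theorem exists_table (L : List State) (Q : State → State → Prop)
    (h : ∀ s ∈ L, ∃ p T, Does p T s (Q s)) :
    ∃ p T, ∀ s ∈ L, Does p T s (Q s) := by
  induction L with
  | nil => exact ⟨.skip, 0, by simp⟩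
  | cons s₀ L ih =>
    obtain ⟨p, T, hp⟩ := ih fun s hs => h s (List.mem_cons_of_mem _ hs)
    by_cases h₀ : s₀ ∈ L
    · exact ⟨p, T, fun s hs => (List.mem_cons.1 hs).elim (fun e => e ▸ hp _ h₀) (hp s)⟩
    · obtain ⟨q, T', hq⟩ := h s₀ List.mem_cons_self
      obtain ⟨e, he, heL⟩ := exists_expr_isolating s₀ L h₀
      refine ⟨.ite e p q, e.cost + 1 + (T + T'), fun s hs => ?_⟩
      rcases List.mem_cons.1 hs with rfl | hs
      · exact does_ite e (fun h => absurd he h) fun _ => hq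
      · exact does_ite e (fun _ => hp s hs) fun h => absurd h (heL s hs)

theorem exists_program_writing {n : ℕ} (S : Finset (Fin n)) :
    ∃ p T, ∀ s, (∀ k, s.arr 1 k = 0) → Does p T s fun s' => output n s' = S := by
  -- The union with the previous output makes the claim inductive, one `store` per node.
  suffices ∃ p T, ∀ s, Does p T s fun s' => output n s' = S ∪ output n s by
    obtain ⟨p, T, h⟩ := this
    refine ⟨p, T, fun s hs => (h s).mono le_rfl fun s' hs' => ?_⟩
    rw [hs']
    ext v
    simp [output, hs]
  induction S using Finset.induction_on with
  | empty => exact ⟨.skip, 1, fun s => does_skip (by simp)⟩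
  | insert v S _ ih =>
    obtain ⟨p, T, h⟩ := ih
    refine ⟨.seq p (.store 1 (.const v) (.const 1)), T + 3, fun s =>
      (h s).seq fun s' hs' => does_store _ _ _ ?_⟩
    rw [insert_union, ← hs']
    ext w
    simp only [output, mem_insert, mem_filter, mem_univ, true_and, Expr.eval,
      Function.update_self]
    by_cases hwv : w = v
    · simp [hwv]
    · have : (w : ℕ) ≠ v := fun h => hwv (Fin.ext h)
      simp [hwv, this]

/-- The table is indexed by memory states; this recovers the graph from its state, so entries for
different graphs cannot conflict. -/
theorem input_injective {n n' : ℕ} {G : SimpleGraph (Fin n)} {G' : SimpleGraph (Fin n')}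
    [DecidableRel G.Adj] [DecidableRel G'.Adj] (h : input G = input G') :
    (⟨n, G⟩ : Σ n, SimpleGraph (Fin n)) = ⟨n', G'⟩ := by
  have h1 := holds_input G
  have h2 := holds_input G'
  rw [← h] at h2
  obtain rfl : n = n' := h1.size.symm.trans h2.size
  congr
  ext i j
  rw [← h1.adj, h2.adj]

/-- On graphs of bounded size, a decision table solves the problem. -/
theorem exists_program_small (n₀ : ℕ) (ζ ε : ℝ) :
    ∃ A T, ∀ n < n₀, ∀ (G : SimpleGraph (Fin n)) [DecidableRel G.Adj],
      (∃ S, IsSmallNonexpanding G ζ ε S) →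
        Does A T (input G) fun s => IsSmallNonexpanding G ζ ε (output n s) := by
  classical
  let Q : State → State → Prop := fun s s' => ∀ (n : ℕ) (G : SimpleGraph (Fin n))
    [DecidableRel G.Adj], input G = s → (∃ S, IsSmallNonexpanding G ζ ε S) →
      IsSmallNonexpanding G ζ ε (output n s')
  let L : List State := (univ : Finset (Σ n : Fin n₀, SimpleGraph (Fin n))).toList.map
    fun q => input q.2
  obtain ⟨p, T, hp⟩ := exists_table L Q fun s hs => by
    obtain ⟨⟨n, G⟩, -, rfl⟩ := List.mem_map.1 hs
    by_cases hS : ∃ S, IsSmallNonexpanding G ζ ε S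
    · obtain ⟨S, hS⟩ := hS
      obtain ⟨p, T, h⟩ := exists_program_writing S
      refine ⟨p, T, (h (input G) (by simp [input])).mono le_rfl ?_⟩
      rintro s' hs' n' G' _ he -
      cases input_injective he
      rw [hs']
      convert hS
    · refine ⟨.skip, 1, does_skip ?_⟩
      rintro n' G' _ he hS'
      cases input_injective he
      refine absurd ?_ hS
      convert hS'
  refine ⟨p, T, fun n hn G _ hS => (hp (input G) ?_).mono le_rfl fun s' hs' => hs' n G rfl hS⟩
  refine List.mem_map.2 ⟨⟨⟨n, hn⟩, G⟩, by simp, ?_⟩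
  congr!

end RAM

/-! ### Assembly of the algorithm -/

/-- The integer test is stronger than the real one because `1/K ≤ ζ` and `1/M ≤ ε`. Volume zero is
harmless, as the quotient is then `0` by convention. -/
theorem isSmallNonexpanding_of_passes {n K M : ℕ} {G : SimpleGraph (Fin n)} [DecidableRel G.Adj]
    {ζ ε : ℝ} (hK : 1 ≤ ζ * K) (hM : 1 ≤ ε * M) (hζ : 0 ≤ ζ) (hε : 0 ≤ ε) {S : Finset (Fin n)}
    (h : RAM.Passes K M G S) : IsSmallNonexpanding G ζ ε S := by
  obtain ⟨hne, hcard, hcut⟩ := h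
  refine ⟨hne, ?_, div_le_of_le_mul₀ (Nat.cast_nonneg _) hε ?_⟩
  · have : (K : ℝ) * S.card ≤ n := by exact_mod_cast hcard
    rw [Fintype.card_fin]
    calc (S.card : ℝ) ≤ ζ * K * S.card := le_mul_of_one_le_left (Nat.cast_nonneg _) hK
      _ = ζ * (K * S.card) := by ring
      _ ≤ ζ * n := mul_le_mul_of_nonneg_left this hζ
  · have : (M : ℝ) * cutSize G S ≤ vol G S := by exact_mod_cast hcut
    calc (cutSize G S : ℝ) ≤ ε * M * cutSize G S := le_mul_of_one_le_left (Nat.cast_nonneg _) hM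
      _ = ε * (M * cutSize G S) := by ring
      _ ≤ ε * vol G S := mul_le_mul_of_nonneg_left this hε

theorem IsHyperbolic.mono {V : Type*} {G : SimpleGraph V} {δ δ' : ℝ} (h : IsHyperbolic G δ)
    (hδ : δ ≤ δ') : IsHyperbolic G δ' := by
  intro u v w p q q' hp hq hq' x hx
  obtain ⟨y, hy, hd⟩ := h u v w p q q' hp hq hq' x hx
  exact ⟨y, hy, hd.trans hδ⟩

theorem exists_one_le_mul_natCast {x : ℝ} (hx : 0 < x) : ∃ K : ℕ, 0 < K ∧ 1 ≤ x * K := by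
  obtain ⟨K, hK⟩ := exists_nat_gt (1 / x)
  refine ⟨K, by exact_mod_cast (one_div_pos.2 hx).trans hK, ?_⟩
  rw [div_lt_iff₀ hx] at hK
  linarith

theorem lemma5 :
    ∃ η : ℝ, 0 < η ∧
      ∀ ρ ζ ε : ℝ, 0 < ρ → ρ < 1 / 3 → 0 < ζ → ζ < 1 / 2 → 0 < ε → ε ≤ 1 →
        ∃ (A : RAM.Program) (P : Polynomial ℕ),
          ∀ (n d : ℕ) (δ : ℝ) (G : SimpleGraph (Fin n)) [DecidableRel G.Adj],
            G.Connected → G.IsRegularOfDegree d → IsHyperbolic G δ →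
            (d : ℝ) ≤ (2 : ℝ) ^ ((Real.logb 2 n) ^ (1 / 3 - ρ)) →
            δ ≤ (Real.logb 2 n) ^ ρ →
            (∃ S : Finset (Fin n), IsSmallNonexpanding G ζ ε S) →
            ∃ (t : ℕ) (s : RAM.State),
              RAM.Exec A (RAM.input G) t s ∧ t ≤ P.eval n ∧
                IsSmallNonexpanding G ζ (η * ε) (RAM.output n s) := by
  refine ⟨1, one_pos, fun ρ ζ ε hρ hρ' hζ _ hε _ => ?_⟩
  simp only [one_mul]
  obtain ⟨K, hK, hζK⟩ := exists_one_le_mul_natCast hζ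
  obtain ⟨M, hM, hεM⟩ := exists_one_le_mul_natCast hε
  obtain ⟨n₀, hn₀⟩ := HyperbolicCut.exists_search_parameters hρ hρ' K M
  obtain ⟨table, T, htable⟩ := RAM.exists_program_small n₀ ζ ε
  obtain ⟨P, hP⟩ := RAM.exists_polynomial_searchTime
  -- The truncated difference `n₀ - n` is nonzero exactly for `n < n₀`, where the table takes over;
  -- evaluating and branching on it costs the `4`.
  refine ⟨.ite (.sub (.const n₀) (.reg 0)) table (RAM.search K M), 4 + (Polynomial.C T + P),
    fun n d δ G _ hG hd hδ hdn hδn hS => ?_⟩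
  have main : RAM.Does (.ite (.sub (.const n₀) (.reg 0)) table (RAM.search K M))
      (4 + (T + RAM.searchTime n)) (RAM.input G)
      fun s => IsSmallNonexpanding G ζ ε (RAM.output n s) := by
    refine RAM.does_ite _ (fun he => htable n ?_ G hS) fun he => ?_
    · simp only [RAM.Expr.eval, (RAM.holds_input G).size] at he
      omega
    · simp only [RAM.Expr.eval, (RAM.holds_input G).size] at he
      obtain ⟨N, r, t₀, t₁, w, hr, ht₀, ht₁, hT, hTn, hw, hD⟩ := hn₀ n (by omega) d hdn
      have hex := HyperbolicCut.exists_small_set_small_cut hG hd (hδ.mono hδn) hK hM hr ht₀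
        (by simpa using ht₁) hT (by simpa using hTn) hw (by simpa using hD)
      simp only [Fintype.card_fin] at hex
      obtain ⟨x, y, p, r, hr, s, hs, U, hU, hUK, hUM⟩ := hex
      refine (RAM.does_search hK (RAM.holds_input G)).mono le_rfl fun s' hs' =>
        isSmallNonexpanding_of_passes hζK hεM hζ.le hε.le (hs' ⟨x, y, r, hr, p, s, hs, ?_⟩)
      rw [← hU]
      refine ⟨⟨p, ?_⟩, hUK, hUM⟩
      rw [hU]
      -- Every stage contains its center, hence is non-empty.
      exact HyperbolicCut.iterate_expand_mono (Nat.zero_le s) (Finset.mem_singleton_self p)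
  obtain ⟨t, s, hexec, ht, hs⟩ := main
  refine ⟨t, s, hexec, ht.trans_eq ?_, hs⟩
  simp [hP]
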